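/- **Conventions.** For a real Banach lattice $X$, its complexification $X_{\mathbb C}=X\oplus iX$ carries the modulus $|x+iy|=\sup_{\theta\in[0,2\pi]}(x\cos\theta+y\sin\theta)\in X$ (this supremum exists) and the norm $\|x+iy\|=\|\,|x+iy|\,\|_X$; the spaces $X_{\mathbb C}$ are the complex Banach lattices. A lattice homomorphism $X_{\mathbb C}\to Y_{\mathbb C}$ is a map $x+iy\mapsto Sx+iSy$ with $S:X\to Y$ a real linear lattice homomorphism. An operator is a bounded linear map. For a real Banach space $F$ let $H_1[F]$ be the space of positively homogeneous functions $f:F^*\to\mathbb R$ with $$\|f\|_{\mathrm{FBL}[F]}=\sup\Big\{\sum_{i=1}^n|f(x_i^*)| : n\in\mathbb N,\ x_1^*,\dots,x_n^*\in F^*,\ \sup_{x\in B_F}\sum_{i=1}^n|x_i^*(x)|\le 1\Big\}<\infty,$$ with the pointwise order, and let $\mathrm{FBL}[F]$ be the closed vector sublattice of $H_1[F]$ generated by the evaluations $\delta_F(x)(x^*)=x^*(x)$, $x\in F$. Let $E$ be a complex Banach space, let $E_{\mathbb R}$ be $E$ regarded as a real Banach space, and endow the vector lattice $\mathrm{FBL}[E_{\mathbb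 R}]$ with $$\|f\|_{\mathrm{FBL}_{\mathbb C}[E]}=\sup\Big\{\sum_{j=1}^m|f(\mathrm{Re}\,z_j^*)| : m\in\mathbb N,\ z_1^*,\dots,z_m^*\in E^*,\ \sup_{z\in B_E}\sum_{j=1}^m|z_j^*(z)|\le 1\Big\}.$$ With this norm $\mathrm{FBL}[E_{\mathbb R}]$ is a real Banach lattice. Let $\mathrm{FBL}_{\mathbb C}[E]=\mathrm{FBL}[E_{\mathbb R}]\oplus i\,\mathrm{FBL}[E_{\mathbb R}]$ be its complexification, and let $\delta_E(z)=\delta_{E_{\mathbb R}}(z)-i\,\delta_{E_{\mathbb R}}(iz)$ for $z\in E$. **Theorem.** The norm of $f=f_1+if_2\in\mathrm{FBL}_{\mathbb C}[E]$ is given by the last displayed formula, with $f(x^*)=f_1(x^*)+if_2(x^*)\in\mathbb C$; and the complex Banach lattice $\mathrm{FBL}_{\mathbb C}[E]$ together with $\delta_E$ is the free complex Banach lattice generated by $E$. That is, $\delta_E:E\to\mathrm{FBL}_{\mathbb C}[E]$ is a $\mathbb C$-linear isometric embedding, and for every complex Banach lattice $X_{\mathbb C}$ and every $\mathbb C$-linear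 operator $T:E\to X_{\mathbb C}$ there is a unique lattice homomorphism $\hat T:\mathrm{FBL}_{\mathbb C}[E]\to X_{\mathbb C}$ with $\hat T\circ\delta_E=T$; moreover $\hat T$ is bounded and $\|\hat T\|=\|T\|$. -/

import Mathlib

open scoped ENNReal

universe u v w

/-! ### Complexification of a real Banach lattice -/

section Modulus

variable {X : Type*} [NormedAddCommGroup X] [NormedSpace ℝ X] [Lattice X]

/-- The set `{x cos θ + y sin θ : θ ∈ [0, 2π]}`, whose supremum is the modulus of `x + i y`. -/
def rotations (x y : X) : Set X :=
  (fun θ : ℝ => Real.cos θ • x + Real.sin θ • y) '' Set.Icc 0 (2 * Real.pi)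

variable [IsOrderedModule ℝ X]

theorem smul_le_abs_smul_abs (a : ℝ) (x : X) : a • x ≤ |a| • |x| := by
  rcases le_total 0 a with h | h
  · rw [abs_of_nonneg h]
    exact smul_le_smul_of_nonneg_left (le_abs_self x) h
  · rw [abs_of_nonpos h]
    have := smul_le_smul_of_nonneg_left (neg_le_abs x) (neg_nonneg.2 h)
    simpa using this

variable [IsOrderedAddMonoid X]

theorem rotation_le (x y : X) (θ τ : ℝ) :
    Real.cos θ • x + Real.sin θ • y
      ≤ (Real.cos τ • x + Real.sin τ • y) + |θ - τ| • (|x| + |y|) := by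
  have h1 : (Real.cos θ - Real.cos τ) • x ≤ |θ - τ| • |x| :=
    (smul_le_abs_smul_abs _ _).trans
      (smul_le_smul_of_nonneg_right (Real.abs_cos_sub_cos_le θ τ) (abs_nonneg x))
  have h2 : (Real.sin θ - Real.sin τ) • y ≤ |θ - τ| • |y| :=
    (smul_le_abs_smul_abs _ _).trans
      (smul_le_smul_of_nonneg_right (Real.abs_sin_sub_sin_le θ τ) (abs_nonneg y))
  have h3 := add_le_add h1 h2
  have h4 := add_le_add_right h3 (Real.cos τ • x + Real.sin τ • y)
  refine le_trans (le_of_eq ?_) (h4.trans (le_of_eq ?_)) <;> module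

variable [HasSolidNorm X] [CompleteSpace X]

/-- In a real Banach lattice the supremum that defines the modulus exists. -/
theorem exists_isLUB_rotations (x y : X) : ∃ m : X, IsLUB (rotations x y) m := by
  set u : X := |x| + |y| with hu
  have hu0 : 0 ≤ u := add_nonneg (abs_nonneg x) (abs_nonneg y)
  set f : ℝ → X := fun θ => Real.cos θ • x + Real.sin θ • y with hf
  set c : ℕ → ℝ := fun n => 2 * Real.pi / (n + 1) with hc
  have hpi := Real.pi_pos
  have hc0 : ∀ n, 0 ≤ c n := fun n => by positivity
  set s : ℕ → X := fun n =>
    (Finset.range (n + 2)).sup' ⟨0, by simp⟩ (fun k : ℕ => f (c n * k)) with hs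
  have key : ∀ n, ∀ θ ∈ Set.Icc 0 (2 * Real.pi), f θ ≤ s n + c n • u := by
    intro n θ hθ
    have hcn : 0 < c n := by positivity
    have hle : ⌊θ / c n⌋₊ ≤ n + 1 := by
      have h1 : θ / c n ≤ ((n + 1 : ℕ) : ℝ) := by
        rw [div_le_iff₀ hcn, hc]
        have : ((n + 1 : ℕ) : ℝ) * (2 * Real.pi / (n + 1)) = 2 * Real.pi := by
          push_cast
          field_simp
        simp only [this]
        exact hθ.2
      have := Nat.floor_mono h1
      rwa [Nat.floor_natCast] at this
    have h2 : |θ - c n * (⌊θ / c n⌋₊ : ℝ)| ≤ c n := by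
      have ha := Nat.floor_le (div_nonneg hθ.1 hcn.le)
      have hb := (Nat.lt_floor_add_one (θ / c n)).le
      rw [le_div_iff₀ hcn] at ha
      rw [div_le_iff₀ hcn] at hb
      rw [abs_le]
      constructor <;> nlinarith
    have h3 : f (c n * (⌊θ / c n⌋₊ : ℝ)) ≤ s n :=
      Finset.le_sup' (fun k : ℕ => f (c n * k)) (by simp; omega)
    exact (rotation_le x y θ _).trans
      (add_le_add h3 (smul_le_smul_of_nonneg_right h2 hu0))
  have mem : ∀ n k : ℕ, k ∈ Finset.range (n + 2) → c n * k ∈ Set.Icc 0 (2 * Real.pi) := by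
    intro n k hk
    have hk' : (k : ℝ) ≤ n + 1 := by
      have : k ≤ n + 1 := by
        have := Finset.mem_range.1 hk
        omega
      exact_mod_cast this
    refine ⟨mul_nonneg (hc0 n) (Nat.cast_nonneg k), ?_⟩
    calc c n * k ≤ c n * (n + 1) := mul_le_mul_of_nonneg_left hk' (hc0 n)
      _ = 2 * Real.pi := by
        simp only [hc]
        field_simp
  have low : ∀ n, ∀ b ∈ upperBounds (rotations x y), s n ≤ b := fun n b hb =>
    Finset.sup'_le _ _ fun k hk => hb ⟨c n * k, mem n k hk, rfl⟩
  have cmp : ∀ m n, s m ≤ s n + c n • u := fun m n =>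
    Finset.sup'_le _ _ fun k hk => key n _ (mem m k hk)
  have dst : ∀ m n, ‖s m - s n‖ ≤ (c m + c n) * ‖u‖ := by
    intro m n
    have hpos : 0 ≤ (c m + c n) • u := smul_nonneg (add_nonneg (hc0 m) (hc0 n)) hu0
    have h : |s m - s n| ≤ |(c m + c n) • u| := by
      rw [abs_of_nonneg hpos, add_smul]
      refine abs_le'.2 ⟨?_, ?_⟩
      · rw [sub_le_iff_le_add]
        refine (cmp m n).trans ?_
        have := smul_nonneg (hc0 m) hu0
        calc s n + c n • u ≤ s n + c n • u + c m • u := le_add_of_nonneg_right this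
          _ = c m • u + c n • u + s n := by abel
      · rw [neg_sub, sub_le_iff_le_add]
        refine (cmp n m).trans ?_
        have := smul_nonneg (hc0 n) hu0
        calc s m + c m • u ≤ s m + c m • u + c n • u := le_add_of_nonneg_right this
          _ = c m • u + c n • u + s m := by abel
    have := HasSolidNorm.solid h
    rwa [norm_smul, Real.norm_of_nonneg (add_nonneg (hc0 m) (hc0 n))] at this
  have clim : Filter.Tendsto c Filter.atTop (nhds 0) := by
    have h := (tendsto_one_div_add_atTop_nhds_zero_nat (𝕜 := ℝ)).const_mul (2 * Real.pi)
    rw [mul_zero] at h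
    refine h.congr fun n => ?_
    simp only [hc]
    ring
  have cau : CauchySeq s := by
    have anti : ∀ N n, N ≤ n → c n ≤ c N := by
      intro N n h
      have : (N : ℝ) ≤ n := by exact_mod_cast h
      simp only [hc]
      gcongr
    refine cauchySeq_of_le_tendsto_0 (fun N => 2 * c N * ‖u‖) ?_ ?_
    · intro n m N hn hm
      rw [dist_eq_norm]
      refine (dst n m).trans ?_
      have h1 := anti N n hn
      have h2 := anti N m hm
      gcongr
      linarith
    · have := (clim.const_mul 2).mul_const ‖u‖
      simpa using this
  obtain ⟨l, hl⟩ := cauchySeq_tendsto_of_complete cau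
  have hl' : Filter.Tendsto (fun n => s n + c n • u) Filter.atTop (nhds l) := by
    have := hl.add (clim.smul_const u)
    simpa using this
  refine ⟨l, ?_, fun b hb => le_of_tendsto' hl fun n => low n b hb⟩
  rintro _ ⟨θ, hθ, rfl⟩
  exact ge_of_tendsto' hl' fun n => key n θ hθ

end Modulus

/-- The complexification `X ⊕ iX` of a real vector space `X`; the pair `(re, im)` stands for
`re + i im`. -/
@[ext]
structure Complexification (X : Type*) where
  re : X
  im : X

namespace Complexification

section Algebra

variable {X : Type*} [AddCommGroup X]

instance : Zero (Complexification X) := ⟨⟨0, 0⟩⟩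
instance : Add (Complexification X) := ⟨fun z w => ⟨z.re + w.re, z.im + w.im⟩⟩
instance : Neg (Complexification X) := ⟨fun z => ⟨-z.re, -z.im⟩⟩

@[simp] theorem zero_re : (0 : Complexification X).re = 0 := rfl
@[simp] theorem zero_im : (0 : Complexification X).im = 0 := rfl
@[simp] theorem add_re (z w : Complexification X) : (z + w).re = z.re + w.re := rfl
@[simp] theorem add_im (z w : Complexification X) : (z + w).im = z.im + w.im := rfl
@[simp] theorem neg_re (z : Complexification X) : (-z).re = -z.re := rfl
@[simp] theorem neg_im (z : Complexification X) : (-z).im = -z.im := rfl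
variable [Module ℝ X]

/-- `(a + i b) (x + i y) = (a x - b y) + i (a y + b x)`. -/
instance : SMul ℂ (Complexification X) :=
  ⟨fun c z => ⟨c.re • z.re - c.im • z.im, c.re • z.im + c.im • z.re⟩⟩

@[simp] theorem smul_re (c : ℂ) (z : Complexification X) :
    (c • z).re = c.re • z.re - c.im • z.im := rfl
@[simp] theorem smul_im (c : ℂ) (z : Complexification X) :
    (c • z).im = c.re • z.im + c.im • z.re := rfl

instance : AddCommGroup (Complexification X) where
  add_assoc a b c := by ext <;> simp [add_assoc]
  zero_add a := by ext <;> simp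
  add_zero a := by ext <;> simp
  neg_add_cancel a := by ext <;> simp
  add_comm a b := by ext <;> simp [add_comm]
  nsmul := nsmulRec
  zsmul := zsmulRec

instance : Module ℂ (Complexification X) where
  one_smul z := by ext <;> simp
  mul_smul a b z := by
    ext
    · simp only [smul_re, smul_im, Complex.mul_re, Complex.mul_im]
      module
    · simp only [smul_re, smul_im, Complex.mul_re, Complex.mul_im]
      module
  smul_zero a := by ext <;> simp
  smul_add a z w := by
    ext
    · simp only [smul_re, add_re, add_im]
      module
    · simp only [smul_im, add_re, add_im]
      module
  add_smul a b z := by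
    ext
    · simp only [smul_re, add_re, Complex.add_re, Complex.add_im]
      module
    · simp only [smul_im, add_im, Complex.add_re, Complex.add_im]
      module
  zero_smul z := by ext <;> simp

end Algebra

section Norm

theorem norm_le_norm_of_nonneg {X : Type*} [NormedAddCommGroup X] [Lattice X]
    [IsOrderedAddMonoid X] [HasSolidNorm X] {a b : X} (ha : 0 ≤ a) (h : a ≤ b) : ‖a‖ ≤ ‖b‖ := by
  refine HasSolidNorm.solid ?_
  rwa [abs_of_nonneg ha, abs_of_nonneg (ha.trans h)]

variable {X : Type*} [NormedAddCommGroup X] [NormedSpace ℝ X] [Lattice X]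
  [IsOrderedAddMonoid X] [IsOrderedModule ℝ X] [HasSolidNorm X] [CompleteSpace X]

/-- The modulus `|x + i y| = sup {x cos θ + y sin θ : θ ∈ [0, 2π]}`, an element of `X`. -/
noncomputable def modulus (z : Complexification X) : X :=
  (exists_isLUB_rotations z.re z.im).choose

theorem isLUB_modulus (z : Complexification X) : IsLUB (rotations z.re z.im) z.modulus :=
  (exists_isLUB_rotations z.re z.im).choose_spec

theorem rotation_le_modulus (z : Complexification X) (θ : ℝ) :
    Real.cos θ • z.re + Real.sin θ • z.im ≤ z.modulus := by
  refine z.isLUB_modulus.1 ⟨toIcoMod Real.two_pi_pos 0 θ, ?_, ?_⟩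
  · have h := toIcoMod_mem_Ico Real.two_pi_pos 0 θ
    rw [zero_add] at h
    exact ⟨h.1, h.2.le⟩
  · have h : toIcoMod Real.two_pi_pos 0 θ
        = θ - toIcoDiv Real.two_pi_pos 0 θ * (2 * Real.pi) := by
      rw [toIcoMod, zsmul_eq_mul]
    simp only [h, Real.cos_sub_int_mul_two_pi, Real.sin_sub_int_mul_two_pi]

theorem modulus_le {z : Complexification X} {m : X}
    (h : ∀ θ : ℝ, Real.cos θ • z.re + Real.sin θ • z.im ≤ m) : z.modulus ≤ m := by
  refine z.isLUB_modulus.2 ?_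
  rintro _ ⟨θ, -, rfl⟩
  exact h θ

theorem abs_re_le_modulus (z : Complexification X) : |z.re| ≤ z.modulus := by
  refine abs_le'.2 ⟨?_, ?_⟩
  · simpa using z.rotation_le_modulus 0
  · simpa using z.rotation_le_modulus Real.pi

theorem abs_im_le_modulus (z : Complexification X) : |z.im| ≤ z.modulus := by
  refine abs_le'.2 ⟨?_, ?_⟩
  · simpa using z.rotation_le_modulus (Real.pi / 2)
  · simpa using z.rotation_le_modulus (-(Real.pi / 2))

theorem modulus_nonneg (z : Complexification X) : 0 ≤ z.modulus :=
  (abs_nonneg _).trans z.abs_re_le_modulus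

theorem modulus_add_le (z w : Complexification X) :
    (z + w).modulus ≤ z.modulus + w.modulus := by
  refine modulus_le fun θ => le_trans (le_of_eq ?_)
    (add_le_add (z.rotation_le_modulus θ) (w.rotation_le_modulus θ))
  simp only [add_re, add_im]
  module

theorem modulus_smul_le (c : ℂ) (z : Complexification X) :
    (c • z).modulus ≤ ‖c‖ • z.modulus := by
  refine modulus_le fun θ => le_trans (le_of_eq ?_)
    (smul_le_smul_of_nonneg_left (z.rotation_le_modulus (θ - c.arg)) (norm_nonneg c))
  have h1 := Complex.norm_mul_cos_arg c
  have h2 := Complex.norm_mul_sin_arg c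
  simp only [smul_re, smul_im, Real.cos_sub, Real.sin_sub]
  rw [← h1, ← h2]
  module

/-- The norm of a complex Banach lattice: `‖x + i y‖ = ‖ |x + i y| ‖`. -/
noncomputable instance : Norm (Complexification X) := ⟨fun z => ‖z.modulus‖⟩

theorem norm_def (z : Complexification X) : ‖z‖ = ‖z.modulus‖ := rfl

theorem norm_smul_le' (c : ℂ) (z : Complexification X) : ‖c • z‖ ≤ ‖c‖ * ‖z‖ := by
  have h := norm_le_norm_of_nonneg (modulus_nonneg _) (modulus_smul_le c z)
  rwa [norm_smul, norm_norm] at h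

theorem normedSpaceCore : NormedSpace.Core ℂ (Complexification X) where
  norm_nonneg z := norm_nonneg z.modulus
  norm_triangle z w :=
    (norm_le_norm_of_nonneg (modulus_nonneg _) (modulus_add_le z w)).trans (norm_add_le _ _)
  norm_smul c z := by
    rcases eq_or_ne c 0 with rfl | hc
    · have h := norm_smul_le' 0 z
      rw [norm_zero, zero_mul] at h ⊢
      exact le_antisymm h (norm_nonneg (modulus ((0 : ℂ) • z)))
    · refine le_antisymm (norm_smul_le' c z) ?_
      have h := norm_smul_le' c⁻¹ (c • z)
      rw [inv_smul_smul₀ hc, norm_inv] at h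
      have hc' : 0 < ‖c‖ := norm_pos_iff.2 hc
      calc ‖c‖ * ‖z‖ ≤ ‖c‖ * (‖c‖⁻¹ * ‖c • z‖) := mul_le_mul_of_nonneg_left h hc'.le
        _ = ‖c • z‖ := by field_simp
  norm_eq_zero_iff z := by
    constructor
    · intro h
      have hm : z.modulus = 0 := norm_eq_zero.1 h
      have h1 := z.abs_re_le_modulus
      have h2 := z.abs_im_le_modulus
      rw [hm] at h1 h2
      ext
      · exact le_antisymm ((le_abs_self _).trans h1) (neg_nonpos.1 ((neg_le_abs _).trans h1))
      · exact le_antisymm ((le_abs_self _).trans h2) (neg_nonpos.1 ((neg_le_abs _).trans h2))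
    · rintro rfl
      have h : (0 : Complexification X).modulus ≤ 0 := modulus_le fun θ => by simp
      rw [norm_def, le_antisymm h (modulus_nonneg _), norm_zero]

noncomputable instance : NormedAddCommGroup (Complexification X) :=
  NormedAddCommGroup.ofCore normedSpaceCore

noncomputable instance : NormedSpace ℂ (Complexification X) :=
  NormedSpace.ofCore normedSpaceCore

end Norm

/-- A lattice homomorphism between complex Banach lattices: the complexification of a (real)
lattice homomorphism. -/
def IsLatticeHom {X Y : Type*} [AddCommGroup X] [Module ℝ X] [Lattice X]
    [AddCommGroup Y] [Module ℝ Y] [Lattice Y]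
    (T : Complexification X →ₗ[ℂ] Complexification Y) : Prop :=
  ∃ S : X →ₗ[ℝ] Y, (∀ x y, S (x ⊔ y) = S x ⊔ S y) ∧ (∀ x y, S (x ⊓ y) = S x ⊓ S y) ∧
    ∀ z, T z = ⟨S z.re, S z.im⟩

end Complexification

/-! ### The free Banach lattice and its renorming -/

/-- The supremum of `∑ j, ‖f (φ j)‖` over all finite tuples `φ` that satisfy `P`. -/
noncomputable def tupleSup {D G : Type*} [Norm G] (P : ∀ m : ℕ, (Fin m → D) → Prop)
    (f : D → G) : ℝ≥0∞ :=
  ⨆ (m : ℕ) (φ : Fin m → D) (_ : P m φ), ENNReal.ofReal (∑ j, ‖f (φ j)‖)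

section TupleSup

variable {D G : Type*} [NormedAddCommGroup G] {P : ∀ m : ℕ, (Fin m → D) → Prop}

theorem le_tupleSup {m : ℕ} {φ : Fin m → D} (h : P m φ) (f : D → G) :
    ENNReal.ofReal (∑ j, ‖f (φ j)‖) ≤ tupleSup P f :=
  le_iSup₂_of_le m φ (le_iSup_of_le h le_rfl)

theorem tupleSup_le {f : D → G} {c : ℝ≥0∞}
    (h : ∀ m (φ : Fin m → D), P m φ → ENNReal.ofReal (∑ j, ‖f (φ j)‖) ≤ c) :
    tupleSup P f ≤ c :=
  iSup_le fun m => iSup₂_le fun φ hφ => h m φ hφ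

theorem tupleSup_zero : tupleSup P (0 : D → G) = 0 :=
  le_antisymm (tupleSup_le fun m φ _ => by simp) zero_le

theorem tupleSup_add_le (f g : D → G) : tupleSup P (f + g) ≤ tupleSup P f + tupleSup P g := by
  refine tupleSup_le fun m φ h => ?_
  calc ENNReal.ofReal (∑ j, ‖(f + g) (φ j)‖)
      ≤ ENNReal.ofReal (∑ j, ‖f (φ j)‖ + ∑ j, ‖g (φ j)‖) := by
        rw [← Finset.sum_add_distrib]
        exact ENNReal.ofReal_le_ofReal (Finset.sum_le_sum fun j _ => norm_add_le _ _)
    _ ≤ _ := ENNReal.ofReal_add_le.trans (add_le_add (le_tupleSup h f) (le_tupleSup h g))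

theorem tupleSup_mono {f g : D → G} (h : ∀ φ, ‖f φ‖ ≤ ‖g φ‖) : tupleSup P f ≤ tupleSup P g :=
  tupleSup_le fun _ _ hP =>
    (ENNReal.ofReal_le_ofReal (Finset.sum_le_sum fun _ _ => h _)).trans (le_tupleSup hP g)

theorem tupleSup_smul_le [NormedSpace ℝ G] (c : ℝ) (f : D → G) :
    tupleSup P (c • f) ≤ ENNReal.ofReal |c| * tupleSup P f := by
  refine tupleSup_le fun m φ h => ?_
  have : ∑ j, ‖(c • f) (φ j)‖ = |c| * ∑ j, ‖f (φ j)‖ := by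
    rw [Finset.mul_sum]
    exact Finset.sum_congr rfl fun j _ => by rw [Pi.smul_apply, norm_smul, Real.norm_eq_abs]
  rw [this, ENNReal.ofReal_mul (abs_nonneg c)]
  exact mul_le_mul_right (le_tupleSup h f) _

end TupleSup

section RealFBL

variable (F : Type*) [NormedAddCommGroup F] [NormedSpace ℝ F]

/-- The tuples of functionals over which the norm of `FBL[F]` is computed. -/
def IsAdmissible (𝕜 : Type*) [RCLike 𝕜] (F : Type*) [NormedAddCommGroup F] [NormedSpace 𝕜 F]
    (m : ℕ) (φ : Fin m → StrongDual 𝕜 F) : Prop :=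
  ∀ x : F, ‖x‖ ≤ 1 → ∑ j, ‖φ j x‖ ≤ 1

variable {F} in
/-- The norm of the free Banach lattice `FBL[F]` over a real space `F`, with value `∞` allowed. -/
noncomputable def fblNorm (f : StrongDual ℝ F → ℝ) : ℝ≥0∞ :=
  tupleSup (IsAdmissible ℝ F) f

/-- The space `H₁[F]` of positively homogeneous functions on the dual with finite norm. -/
noncomputable def H1 : Submodule ℝ (StrongDual ℝ F → ℝ) where
  carrier := {f | (∀ (c : ℝ) (φ : StrongDual ℝ F), 0 ≤ c → f (c • φ) = c * f φ) ∧ fblNorm f < ∞}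
  zero_mem' := by
    refine ⟨fun c φ _ => by simp, ?_⟩
    rw [fblNorm, tupleSup_zero]
    exact ENNReal.zero_lt_top
  add_mem' := by
    rintro f g ⟨hf, hf'⟩ ⟨hg, hg'⟩
    refine ⟨fun c φ hc => ?_, (tupleSup_add_le f g).trans_lt (ENNReal.add_lt_top.2 ⟨hf', hg'⟩)⟩
    simp only [Pi.add_apply, hf c φ hc, hg c φ hc, mul_add]
  smul_mem' := by
    rintro a f ⟨hf, hf'⟩
    refine ⟨fun c φ hc => ?_,
      (tupleSup_smul_le a f).trans_lt (ENNReal.mul_lt_top ENNReal.ofReal_lt_top hf')⟩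
    simp only [Pi.smul_apply, smul_eq_mul, hf c φ hc]
    ring

variable {F} in
/-- Closed vector sublattices of the Banach lattice `H₁[F]` (with pointwise order). -/
structure IsClosedSublattice (S : Submodule ℝ (StrongDual ℝ F → ℝ)) : Prop where
  le_H1 : S ≤ H1 F
  sup_mem : ∀ f ∈ S, ∀ g ∈ S, f ⊔ g ∈ S
  closed : ∀ f ∈ H1 F, (∀ ε : ℝ≥0∞, 0 < ε → ∃ g ∈ S, fblNorm (f - g) < ε) → f ∈ S

variable {F} in
/-- The evaluation function `δ_x`, `δ_x(x*) = x*(x)`. -/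
def evalFun (x : F) : StrongDual ℝ F → ℝ := fun φ => φ x

/-- The free Banach lattice `FBL[F]`: the closed sublattice of `H₁[F]` generated by the
evaluations `δ_x`. -/
noncomputable def FBL : Submodule ℝ (StrongDual ℝ F → ℝ) :=
  sInf {S | IsClosedSublattice S ∧ ∀ x : F, evalFun x ∈ S}

variable {F}

theorem evalFun_mem_FBL (x : F) : evalFun x ∈ FBL F :=
  (Submodule.mem_sInf).2 fun _ hS => hS.2 x

theorem evalFun_mem_H1 (x : F) : evalFun x ∈ H1 F := by
  refine ⟨fun c φ _ => by simp [evalFun], ?_⟩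
  refine lt_of_le_of_lt (tupleSup_le (c := ENNReal.ofReal (‖x‖ + 1)) fun m φ h => ?_)
    ENNReal.ofReal_lt_top
  refine ENNReal.ofReal_le_ofReal ?_
  have hx : 0 < ‖x‖ + 1 := by positivity
  have h1 := h ((‖x‖ + 1)⁻¹ • x) (by
    rw [norm_smul, Real.norm_of_nonneg (inv_nonneg.2 hx.le), inv_mul_le_iff₀ hx]
    linarith)
  have h2 : ∑ j, ‖φ j ((‖x‖ + 1)⁻¹ • x)‖ = (‖x‖ + 1)⁻¹ * ∑ j, ‖evalFun x (φ j)‖ := by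
    rw [Finset.mul_sum]
    refine Finset.sum_congr rfl fun j _ => ?_
    rw [map_smul, norm_smul, Real.norm_of_nonneg (inv_nonneg.2 hx.le)]
    rfl
  rw [h2, inv_mul_le_iff₀ hx, mul_one] at h1
  exact h1

theorem abs_sup_le_abs_add (a b : ℝ) : |a ⊔ b| ≤ ‖|a| + |b|‖ := by
  rw [Real.norm_of_nonneg (by positivity)]
  rcases max_cases a b with h | h <;> rw [h.1]
  · linarith [abs_nonneg b]
  · linarith [abs_nonneg a]

theorem isClosedSublattice_H1 : IsClosedSublattice (H1 F) where
  le_H1 := le_rfl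
  closed f hf _ := hf
  sup_mem := by
    rintro f ⟨hf, hf'⟩ g ⟨hg, hg'⟩
    constructor
    · intro c φ hc
      simp only [Pi.sup_apply, hf c φ hc, hg c φ hc]
      exact (mul_max_of_nonneg _ _ hc).symm
    · have h1 : fblNorm (f ⊔ g) ≤ fblNorm (|f| + |g|) :=
        tupleSup_mono fun φ => abs_sup_le_abs_add _ _
      have h2 : fblNorm |f| ≤ fblNorm f := tupleSup_mono fun φ => by simp
      have h3 : fblNorm |g| ≤ fblNorm g := tupleSup_mono fun φ => by simp
      exact (h1.trans ((tupleSup_add_le _ _).trans (add_le_add h2 h3))).trans_lt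
        (ENNReal.add_lt_top.2 ⟨hf', hg'⟩)

/-- `FBL[F]` is itself a closed sublattice of `H₁[F]`. -/
theorem isClosedSublattice_FBL : IsClosedSublattice (FBL F) where
  le_H1 := sInf_le ⟨isClosedSublattice_H1, evalFun_mem_H1⟩
  sup_mem f hf g hg := Submodule.mem_sInf.2 fun S hS =>
    hS.1.sup_mem f (Submodule.mem_sInf.1 hf S hS) g (Submodule.mem_sInf.1 hg S hS)
  closed f hf h := Submodule.mem_sInf.2 fun S hS => hS.1.closed f hf fun ε hε => by
    obtain ⟨g, hg, hg'⟩ := h ε hε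
    exact ⟨g, Submodule.mem_sInf.1 hg S hS, hg'⟩

theorem inf_mem_FBL {f g : StrongDual ℝ F → ℝ} (hf : f ∈ FBL F) (hg : g ∈ FBL F) :
    f ⊓ g ∈ FBL F := by
  have h := neg_mem (isClosedSublattice_FBL.sup_mem _ (neg_mem hf) _ (neg_mem hg))
  rwa [neg_sup, neg_neg, neg_neg] at h

end RealFBL

section Renorming

variable {E : Type*} [NormedAddCommGroup E] [NormedSpace ℂ E]

/-- The real part `Re z*` of a complex functional, a real functional on `E_ℝ`. -/
noncomputable def rePart (z : StrongDual ℂ E) : StrongDual ℝ E :=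
  Complex.reCLM.comp (z.restrictScalars ℝ)

@[simp] theorem rePart_apply (z : StrongDual ℂ E) (x : E) : rePart z x = (z x).re := rfl

/-- The supremum of `∑ j, ‖f (Re z_j*)‖` over tuples in `E*` with
`∑ j, |z_j*(z)| ≤ 1` for all `z` in the unit ball of `E`. -/
noncomputable def cfblNorm {G : Type*} [Norm G] (f : StrongDual ℝ E → G) : ℝ≥0∞ :=
  tupleSup (IsAdmissible ℂ E) (fun z => f (rePart z))

theorem exists_rePart (φ : StrongDual ℝ E) : ∃ z : StrongDual ℂ E, rePart z = φ := by
  refine ⟨φ.extendRCLike, ?_⟩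
  ext x
  exact StrongDual.re_extendRCLike_apply (𝕜 := ℂ) φ x

theorem cfblNorm_le (f : StrongDual ℝ E → ℝ) : cfblNorm f ≤ fblNorm f := by
  refine tupleSup_le fun m z h => le_tupleSup (φ := fun j => rePart (z j)) (fun x hx => ?_) f
  exact (Finset.sum_le_sum fun j _ => Complex.abs_re_le_norm (z j x)).trans (h x hx)

theorem fblNorm_le {f : StrongDual ℝ E → ℝ} (hf : f ∈ H1 E) : fblNorm f ≤ 2 * cfblNorm f := by
  refine tupleSup_le fun m φ h => ?_
  choose z hz using fun j => exists_rePart (φ j)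
  have hadm : IsAdmissible ℂ E m (fun j => ((1 / 2 : ℝ) : ℂ) • z j) := by
    intro x hx
    have h1 := h x hx
    have h2 := h ((-Complex.I) • x) (by simpa [norm_smul] using hx)
    calc ∑ j, ‖(((1 / 2 : ℝ) : ℂ) • z j) x‖
        ≤ ∑ j, (1 / 2) * (‖φ j x‖ + ‖φ j ((-Complex.I) • x)‖) := by
          refine Finset.sum_le_sum fun j _ => ?_
          have h3 := Complex.norm_le_abs_re_add_abs_im (z j x)
          rw [← hz j, rePart_apply, rePart_apply, map_smul, smul_apply,
            norm_smul, Complex.norm_real]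
          simp only [Real.norm_eq_abs]
          rw [abs_of_pos (by norm_num : (0 : ℝ) < 1 / 2)]
          simp at h3 ⊢
          linarith
      _ ≤ 1 := by
          rw [← Finset.mul_sum, Finset.sum_add_distrib]
          linarith
  have h4 := le_tupleSup hadm (fun z => f (rePart z))
  have h5 : ∀ j, f (rePart (((1 / 2 : ℝ) : ℂ) • z j)) = (1 / 2) * f (φ j) := by
    intro j
    rw [← hf.1 (1 / 2) (φ j) (by norm_num), ← hz j]
    congr 1
    ext x
    simp
  simp only [h5, norm_mul, ← Finset.mul_sum] at h4
  rw [ENNReal.ofReal_mul (norm_nonneg _)] at h4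
  calc ENNReal.ofReal (∑ j, ‖f (φ j)‖)
      = 2 * (ENNReal.ofReal ‖(1 / 2 : ℝ)‖ * ENNReal.ofReal (∑ j, ‖f (φ j)‖)) := by
        rw [← mul_assoc]
        have : (2 : ℝ≥0∞) * ENNReal.ofReal ‖(1 / 2 : ℝ)‖ = 1 := by
          rw [← ENNReal.ofReal_ofNat 2, ← ENNReal.ofReal_mul (by norm_num)]
          norm_num
        rw [this, one_mul]
    _ ≤ _ := mul_le_mul_right h4 _

theorem cfblNorm_ne_top {f : StrongDual ℝ E → ℝ} (hf : f ∈ FBL E) : cfblNorm f ≠ ∞ :=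
  ((cfblNorm_le f).trans_lt (isClosedSublattice_FBL.le_H1 hf).2).ne

theorem abs_apply_le {f : StrongDual ℝ E → ℝ} (hf : f ∈ FBL E) (φ : StrongDual ℝ E) :
    |f φ| ≤ (‖φ‖ + 1) * (cfblNorm f).toReal := by
  obtain ⟨z, hz, hn⟩ : ∃ z : StrongDual ℂ E, rePart z = φ ∧ ‖z‖ = ‖φ‖ := by
    refine ⟨φ.extendRCLike, ?_, StrongDual.norm_extendRCLike φ⟩
    ext x
    exact StrongDual.re_extendRCLike_apply (𝕜 := ℂ) φ x
  have hc : 0 < ‖φ‖ + 1 := by positivity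
  have hadm : IsAdmissible ℂ E 1 (fun _ => (((‖φ‖ + 1)⁻¹ : ℝ) : ℂ) • z) := by
    intro x hx
    rw [Fin.sum_univ_one, smul_apply, norm_smul, Complex.norm_real,
      Real.norm_of_nonneg (inv_nonneg.2 hc.le), inv_mul_le_iff₀ hc]
    have := z.le_opNorm x
    have h2 : ‖z‖ * ‖x‖ ≤ ‖z‖ * 1 := mul_le_mul_of_nonneg_left hx (norm_nonneg _)
    linarith
  have h : _ ≤ cfblNorm f := le_tupleSup hadm (fun z => f (rePart z))
  have h5 : f (rePart ((((‖φ‖ + 1)⁻¹ : ℝ) : ℂ) • z)) = (‖φ‖ + 1)⁻¹ * f φ := by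
    rw [← (isClosedSublattice_FBL.le_H1 hf).1 _ φ (inv_nonneg.2 hc.le)]
    congr 1
    ext x
    simp only [rePart_apply, smul_apply, smul_eq_mul, Complex.re_ofReal_mul, ← hz]
  rw [Fin.sum_univ_one, h5, norm_mul, Real.norm_of_nonneg (inv_nonneg.2 hc.le),
    ENNReal.ofReal_le_iff_le_toReal (cfblNorm_ne_top hf), inv_mul_le_iff₀ hc] at h
  exact h

variable (E) in
/-- The vector lattice `FBL[E_ℝ]`, to be endowed with the norm `‖·‖_{FBL_ℂ[E]}`. -/
def RenormedFBL : Type _ := FBL E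

namespace RenormedFBL

noncomputable instance : AddCommGroup (RenormedFBL E) := inferInstanceAs (AddCommGroup (FBL E))
noncomputable instance : Module ℝ (RenormedFBL E) := inferInstanceAs (Module ℝ (FBL E))

instance : CoeFun (RenormedFBL E) (fun _ => StrongDual ℝ E → ℝ) := ⟨Subtype.val⟩

/-- Pointwise order and lattice operations. -/
noncomputable instance : Lattice (RenormedFBL E) where
  le f g := f.1 ≤ g.1
  le_refl f := le_refl f.1
  le_trans f g h := le_trans (a := f.1) (b := g.1) (c := h.1)
  le_antisymm f g h h' := Subtype.ext (le_antisymm (a := f.1) (b := g.1) h h')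
  sup f g := ⟨f.1 ⊔ g.1, isClosedSublattice_FBL.sup_mem _ f.2 _ g.2⟩
  inf f g := ⟨f.1 ⊓ g.1, inf_mem_FBL f.2 g.2⟩
  le_sup_left f g := le_sup_left (a := f.1) (b := g.1)
  le_sup_right f g := le_sup_right (a := f.1) (b := g.1)
  sup_le f g h := sup_le (a := f.1) (b := g.1) (c := h.1)
  inf_le_left f g := inf_le_left (a := f.1) (b := g.1)
  inf_le_right f g := inf_le_right (a := f.1) (b := g.1)
  le_inf f g h := le_inf (c := f.1) (a := g.1) (b := h.1)

instance : IsOrderedAddMonoid (RenormedFBL E) where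
  add_le_add_left _ _ h k := add_le_add_left (α := StrongDual ℝ E → ℝ) h k.1

instance : IsOrderedModule ℝ (RenormedFBL E) where
  smul_le_smul_of_nonneg_left _ ha _ _ h := fun φ => mul_le_mul_of_nonneg_left (h φ) ha
  smul_le_smul_of_nonneg_right _ hf _ _ h := fun φ => mul_le_mul_of_nonneg_right h (hf φ)

noncomputable instance : Norm (RenormedFBL E) :=
  ⟨fun f => (cfblNorm (f : StrongDual ℝ E → ℝ)).toReal⟩

theorem norm_def (f : RenormedFBL E) : ‖f‖ = (cfblNorm (f : StrongDual ℝ E → ℝ)).toReal := rfl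

theorem ofReal_norm (f : RenormedFBL E) : ENNReal.ofReal ‖f‖ = cfblNorm f.1 :=
  ENNReal.ofReal_toReal (cfblNorm_ne_top f.2)

theorem norm_smul_le' (c : ℝ) (f : RenormedFBL E) : ‖c • f‖ ≤ ‖c‖ * ‖f‖ := by
  have h : cfblNorm (c • f.1) ≤ ENNReal.ofReal |c| * cfblNorm f.1 := tupleSup_smul_le c _
  have h2 := ENNReal.toReal_mono
    (ENNReal.mul_ne_top ENNReal.ofReal_ne_top (cfblNorm_ne_top f.2)) h
  rw [ENNReal.toReal_mul, ENNReal.toReal_ofReal (abs_nonneg c)] at h2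
  exact h2

theorem normedSpaceCore : NormedSpace.Core ℝ (RenormedFBL E) where
  norm_nonneg _ := ENNReal.toReal_nonneg
  norm_triangle f g := by
    have h : cfblNorm (f.1 + g.1) ≤ cfblNorm f.1 + cfblNorm g.1 := tupleSup_add_le _ _
    have h2 := ENNReal.toReal_mono
      (ENNReal.add_ne_top.2 ⟨cfblNorm_ne_top f.2, cfblNorm_ne_top g.2⟩) h
    rw [ENNReal.toReal_add (cfblNorm_ne_top f.2) (cfblNorm_ne_top g.2)] at h2
    exact h2
  norm_smul c f := by
    rcases eq_or_ne c 0 with rfl | hc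
    · have h := norm_smul_le' 0 f
      rw [norm_zero, zero_mul] at h ⊢
      exact le_antisymm h ENNReal.toReal_nonneg
    · refine le_antisymm (norm_smul_le' c f) ?_
      have h := norm_smul_le' c⁻¹ (c • f)
      rw [inv_smul_smul₀ hc, norm_inv] at h
      have hc' : 0 < ‖c‖ := norm_pos_iff.2 hc
      calc ‖c‖ * ‖f‖ ≤ ‖c‖ * (‖c‖⁻¹ * ‖c • f‖) := mul_le_mul_of_nonneg_left h hc'.le
        _ = ‖c • f‖ := by field_simp
  norm_eq_zero_iff f := by
    constructor
    · intro h
      refine Subtype.ext (funext fun φ => ?_)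
      have h1 := abs_apply_le f.2 φ
      rw [← norm_def, h, mul_zero] at h1
      exact abs_nonpos_iff.1 h1
    · rintro rfl
      have h : cfblNorm (0 : StrongDual ℝ E → ℝ) = 0 := tupleSup_zero
      change (cfblNorm (0 : StrongDual ℝ E → ℝ)).toReal = 0
      rw [h, ENNReal.toReal_zero]

noncomputable instance : NormedAddCommGroup (RenormedFBL E) :=
  NormedAddCommGroup.ofCore normedSpaceCore

noncomputable instance : NormedSpace ℝ (RenormedFBL E) :=
  NormedSpace.ofCore normedSpaceCore

instance : HasSolidNorm (RenormedFBL E) where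
  solid _ g h := ENNReal.toReal_mono (cfblNorm_ne_top g.2) (tupleSup_mono fun z => h (rePart z))

instance : CompleteSpace (RenormedFBL E) := by
  refine Metric.complete_of_cauchySeq_tendsto fun u hu => ?_
  have hsub : ∀ n m φ, |u n φ - u m φ| ≤ (‖φ‖ + 1) * ‖u n - u m‖ := fun n m φ =>
    abs_apply_le (u n - u m).2 φ
  have hpt : ∀ φ, ∃ l, Filter.Tendsto (fun n => u n φ) Filter.atTop (nhds l) := by
    intro φ
    refine cauchySeq_tendsto_of_complete (Metric.cauchySeq_iff.2 fun ε hε => ?_)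
    have hc : 0 < ‖φ‖ + 1 := by positivity
    obtain ⟨N, hN⟩ := Metric.cauchySeq_iff.1 hu (ε / (‖φ‖ + 1)) (by positivity)
    refine ⟨N, fun m hm n hn => ?_⟩
    have h1 := hN m hm n hn
    rw [dist_eq_norm, lt_div_iff₀ hc] at h1
    rw [Real.dist_eq]
    exact (hsub m n φ).trans_lt (by linarith)
  choose g hg using hpt
  have hnear : ∀ ε : ℝ, 0 < ε → ∃ N, ∀ n ≥ N, fblNorm (g - (u n).1) ≤ ENNReal.ofReal ε := by
    intro ε hε
    obtain ⟨N, hN⟩ := Metric.cauchySeq_iff.1 hu (ε / 2) (by positivity)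
    refine ⟨N, fun n hn => tupleSup_le fun m φ hφ => ENNReal.ofReal_le_ofReal ?_⟩
    have hlim : Filter.Tendsto (fun k => ∑ j, ‖u k (φ j) - u n (φ j)‖) Filter.atTop
        (nhds (∑ j, ‖(g - (u n).1) (φ j)‖)) :=
      tendsto_finsetSum _ fun j _ => ((hg (φ j)).sub_const _).norm
    refine le_of_tendsto hlim (Filter.eventually_atTop.2 ⟨N, fun k hk => ?_⟩)
    have h1 : ENNReal.ofReal (∑ j, ‖u k (φ j) - u n (φ j)‖) ≤ ENNReal.ofReal ε := by
      calc _ ≤ fblNorm (u k - u n).1 := le_tupleSup hφ (u k - u n).1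
        _ ≤ 2 * cfblNorm (u k - u n).1 :=
          fblNorm_le (isClosedSublattice_FBL.le_H1 (u k - u n).2)
        _ = ENNReal.ofReal (2 * ‖u k - u n‖) := by
          rw [← ofReal_norm, ENNReal.ofReal_mul (by norm_num), ENNReal.ofReal_ofNat]
        _ ≤ ENNReal.ofReal ε := by
          have := hN k hk n hn
          rw [dist_eq_norm] at this
          exact ENNReal.ofReal_le_ofReal (by linarith)
    exact (ENNReal.ofReal_le_ofReal_iff hε.le).1 h1
  have hH1 : g ∈ H1 E := by
    constructor
    · intro c φ hc
      refine tendsto_nhds_unique (hg (c • φ)) (((hg φ).const_mul c).congr fun n => ?_)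
      exact ((isClosedSublattice_FBL.le_H1 (u n).2).1 c φ hc).symm
    · obtain ⟨N, hN⟩ := hnear 1 one_pos
      have h1 := hN N le_rfl
      have h2 := tupleSup_add_le (P := IsAdmissible ℝ E) (g - (u N).1) (u N).1
      rw [sub_add_cancel] at h2
      exact (h2.trans (add_le_add_left h1 _)).trans_lt
        (ENNReal.add_lt_top.2 ⟨ENNReal.ofReal_lt_top, (isClosedSublattice_FBL.le_H1 (u N).2).2⟩)
  have hmem : g ∈ FBL E := by
    refine isClosedSublattice_FBL.closed g hH1 fun ε hε => ?_
    obtain ⟨r, hr, hr'⟩ := ENNReal.lt_iff_exists_real_btwn.1 hε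
    have hr0 : 0 < r := ENNReal.ofReal_pos.1 hr'.1
    obtain ⟨N, hN⟩ := hnear r hr0
    exact ⟨(u N).1, (u N).2, (hN N le_rfl).trans_lt hr'.2⟩
  let g' : RenormedFBL E := ⟨g, hmem⟩
  refine ⟨g', Metric.tendsto_atTop.2 fun ε hε => ?_⟩
  obtain ⟨N, hN⟩ := hnear (ε / 2) (by positivity)
  refine ⟨N, fun n hn => ?_⟩
  rw [dist_comm, dist_eq_norm]
  have h1 : cfblNorm (g - (u n).1) ≤ ENNReal.ofReal (ε / 2) := (cfblNorm_le _).trans (hN n hn)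
  have h2 : ‖g' - u n‖ ≤ ε / 2 :=
    ENNReal.toReal_le_of_le_ofReal (by positivity) h1
  linarith

end RenormedFBL

end Renorming

/-! ### The free complex Banach lattice -/

/-- The free complex Banach lattice `FBL_ℂ[E] = FBL[E_ℝ] ⊕ i FBL[E_ℝ]`. -/
abbrev FBLC (E : Type*) [NormedAddCommGroup E] [NormedSpace ℂ E] : Type _ :=
  Complexification (RenormedFBL E)

/-- The canonical map `δ_{E_ℝ} : E → FBL[E_ℝ]`. -/
noncomputable def deltaReal {E : Type*} [NormedAddCommGroup E] [NormedSpace ℂ E] (x : E) :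
    RenormedFBL E := ⟨evalFun x, evalFun_mem_FBL x⟩

/-- The canonical map `δ_E(z) = δ_{E_ℝ}(z) - i δ_{E_ℝ}(i z)`. -/
noncomputable def deltaC {E : Type*} [NormedAddCommGroup E] [NormedSpace ℂ E] (z : E) : FBLC E :=
  ⟨deltaReal z, -deltaReal (Complex.I • z)⟩

/-- `(L ⊕ iL, δ)`, with `L` a real Banach lattice, is the free complex Banach lattice generated by
the complex Banach space `E`. The uniqueness is among all lattice homomorphisms, bounded or not. -/
structure IsFreeComplexBanachLattice (E : Type u) [NormedAddCommGroup E]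
    [NormedSpace ℂ E] (L : Type v) [NormedAddCommGroup L] [NormedSpace ℝ L] [Lattice L]
    [IsOrderedAddMonoid L] [IsOrderedModule ℝ L] [HasSolidNorm L] [CompleteSpace L]
    (δ : E → Complexification L) : Prop where
  isLinearMap : IsLinearMap ℂ δ
  isometry : Isometry δ
  existsUnique_extension : ∀ (X : Type w) [NormedAddCommGroup X] [NormedSpace ℝ X] [Lattice X]
    [IsOrderedAddMonoid X] [IsOrderedModule ℝ X] [HasSolidNorm X] [CompleteSpace X]
    (T : E →L[ℂ] Complexification X),
    ∃ T' : Complexification L →L[ℂ] Complexification X,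
      Complexification.IsLatticeHom (T' : Complexification L →ₗ[ℂ] Complexification X) ∧
      (∀ z, T' (δ z) = T z) ∧ ‖T'‖ = ‖T‖ ∧
      ∀ R : Complexification L →ₗ[ℂ] Complexification X,
        Complexification.IsLatticeHom R → (∀ z, R (δ z) = T z) → ∀ f, R f = T' f

/-! Existence. Let R = Re T. The extension S should satisfy S δ_x = R x, and for a real lattice
homomorphism y on X it would have to satisfy y(S f) = f(y ∘ R). A Banach lattice X may lack such y,
but every positive functional splits into finitely many positive ones that behave like lattice
homomorphisms on a given finite set of suprema (`IsPositiveFunctional.exists_add_eq_sup`, by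
Hahn–Banach). So the graph of S is approximated by the pairs (f, u) for which each positive y is a
finite sum of positive y_j with f(y' ∘ R) = y'(u) whenever 0 ≤ y' ≤ y_j. These pairs form a vector
sublattice containing (δ_x, R x).

The norm bound (`norm_le_of_mem_representationSubmodule`) comes from a positive y that norms |u|:
‖u‖ = ∑ y_j(|u|) = ∑ |f(y_j ∘ R)|. The complex functionals z_j with real part y_j ∘ R satisfy ∑
|z_j(x)| ≤ ∑ y_j(|T x|) = y(|T x|) ≤ ‖T‖ ‖x‖, so the sum is at most ‖T‖ ‖f‖. This is where the
renorming by complex tuples is exactly right. By the bound, the closure of the set of pairs is the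
graph of a bounded lattice homomorphism on a closed sublattice containing the evaluations, hence on
everything.

Uniqueness. Positive maps on a Banach lattice are automatically bounded, so two lattice
homomorphisms that agree on the evaluations agree on the closed sublattice these generate.

Norm formula and isometry. Point evaluations are real lattice homomorphisms, and these carry the
modulus to the absolute value (`Complexification.map_modulus_eq_norm`), so the modulus is pointwise.
At Re z* the function δ_E(x) takes the value z*(x), and Hahn–Banach gives the isometry. -/

/-! ### Hahn–Banach and positive parts. -/

/-- Hahn–Banach from the line through v, where t v ↦ t p(v). Nonnegativity of p settles domination
for t ≤ 0. -/
theorem exists_linear_le_sublinear_eq {X : Type*} [AddCommGroup X] [Module ℝ X] (p : X → ℝ)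
    (p_smul : ∀ c : ℝ, 0 < c → ∀ x, p (c • x) = c * p x) (p_add : ∀ x y, p (x + y) ≤ p x + p y)
    (p_nonneg : ∀ x, 0 ≤ p x) (v : X) : ∃ f : X →ₗ[ℝ] ℝ, (∀ x, f x ≤ p x) ∧ f v = p v := by
  have p0 : p 0 = 0 := by
    have h := p_smul 2 two_pos 0
    rw [smul_zero] at h
    linarith
  rcases eq_or_ne v 0 with rfl | hv
  · exact ⟨0, fun x => by simpa using p_nonneg x, by simp [p0]⟩
  obtain ⟨g, hg, hg'⟩ := exists_extension_of_le_sublinear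
    (LinearPMap.mkSpanSingleton (K := ℝ) v (p v) hv) p p_smul p_add (by
      rintro ⟨x, hx⟩
      obtain ⟨t, rfl⟩ := Submodule.mem_span_singleton.1 hx
      rw [LinearPMap.mkSpanSingleton'_apply, RingHom.id_apply, smul_eq_mul]
      rcases lt_or_ge 0 t with h | h
      · exact (p_smul t h v).ge
      · exact (mul_nonpos_of_nonpos_of_nonneg h (p_nonneg v)).trans (p_nonneg _))
  refine ⟨g, hg', ?_⟩
  have h := hg ⟨v, Submodule.mem_span_singleton_self v⟩
  exact h.trans (LinearPMap.mkSpanSingleton'_apply_self v (p v) _ _)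

/-- A functional on a normed lattice is positive if it is nonnegative on the positive cone. -/
def IsPositiveFunctional {X : Type*} [NormedAddCommGroup X] [NormedSpace ℝ X] [Lattice X]
    (y : StrongDual ℝ X) : Prop := ∀ x : X, 0 ≤ x → 0 ≤ y x

theorem IsPositiveFunctional.mono {X : Type*} [NormedAddCommGroup X] [NormedSpace ℝ X]
    [Lattice X] [IsOrderedAddMonoid X] {y : StrongDual ℝ X} (hy : IsPositiveFunctional y) {a b : X}
    (h : a ≤ b) : y a ≤ y b := by
  have := hy (b - a) (sub_nonneg.2 h)
  rw [map_sub] at this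
  linarith

theorem posPart_smul_of_pos {X : Type*} [AddCommGroup X] [Module ℝ X] [Lattice X]
    [IsOrderedModule ℝ X] {c : ℝ} (hc : 0 < c) (x : X) : (c • x)⁺ = c • x⁺ := by
  refine le_antisymm (sup_le (smul_le_smul_of_nonneg_left (le_posPart x) hc.le)
    (smul_nonneg hc.le (posPart_nonneg x))) ?_
  rw [← le_inv_smul_iff_of_pos hc]
  refine sup_le ?_ (smul_nonneg (inv_nonneg.2 hc.le) (posPart_nonneg _))
  rw [le_inv_smul_iff_of_pos hc]
  exact le_posPart _

theorem posPart_add_le {X : Type*} [AddCommGroup X] [Lattice X] [IsOrderedAddMonoid X] (x y : X) : (x + y)⁺ ≤ x⁺ + y⁺ :=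
  sup_le (add_le_add (le_posPart x) (le_posPart y))
    (add_nonneg (posPart_nonneg x) (posPart_nonneg y))

/-- Makes the functionals obtained from Hahn–Banach continuous: the one-sided estimate is used at x
and at -x. -/
theorem abs_le_norm_of_le_posPart {X : Type*} [NormedAddCommGroup X] [NormedSpace ℝ X] [Lattice X]
    [IsOrderedAddMonoid X] [HasSolidNorm X] {f : X →ₗ[ℝ] ℝ} {C : ℝ}
    (h : ∀ x, f x ≤ C * ‖x⁺‖) (hC : 0 ≤ C) (x : X) : ‖f x‖ ≤ C * ‖x‖ := by
  have key : ∀ z : X, ‖z⁺‖ ≤ ‖z‖ := fun z => by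
    refine HasSolidNorm.solid ?_
    rw [abs_of_nonneg (posPart_nonneg z)]
    exact sup_le (le_abs_self z) (abs_nonneg z)
  have h1 := (h x).trans (mul_le_mul_of_nonneg_left (key x) hC)
  have h2 := (h (-x)).trans (mul_le_mul_of_nonneg_left (key (-x)) hC)
  rw [map_neg, norm_neg] at h2
  exact abs_le'.2 ⟨h1, h2⟩

theorem LinearMap.map_nonneg_of_map_sup {X Y : Type*} [AddCommGroup X] [Module ℝ X] [Lattice X]
     [AddCommGroup Y] [Module ℝ Y] [Lattice Y]
    (S : X →ₗ[ℝ] Y) (hS : ∀ x y, S (x ⊔ y) = S x ⊔ S y) (x : X) (hx : 0 ≤ x) : 0 ≤ S x := by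
  have h := hS x 0
  rw [sup_of_le_left hx, map_zero] at h
  rw [h]
  exact le_sup_right

/-! ### Positive functionals and automatic boundedness. -/

section PositiveFunctionals

variable {X : Type*} [NormedAddCommGroup X] [NormedSpace ℝ X] [Lattice X]
  [IsOrderedAddMonoid X] [IsOrderedModule ℝ X] [HasSolidNorm X]

/-- A positive vector is normed by a positive functional. -/
theorem exists_isPositiveFunctional_eq_norm {v : X} (hv : 0 ≤ v) :
    ∃ y : StrongDual ℝ X, IsPositiveFunctional y ∧ (∀ x, y x ≤ ‖x‖) ∧ y v = ‖v‖ := by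
  -- Dominating by ‖x⁺‖ instead of ‖x‖ forces positivity: f(-x) ≤ ‖(-x)⁺‖ = 0 for x ≥ 0.
  obtain ⟨f, hf, hfv⟩ := exists_linear_le_sublinear_eq (fun x : X => ‖x⁺‖)
    (fun c hc x => by simp only [posPart_smul_of_pos hc, norm_smul, Real.norm_of_nonneg hc.le])
    (fun x y => (Complexification.norm_le_norm_of_nonneg (posPart_nonneg _)
      (posPart_add_le x y)).trans (norm_add_le _ _))
    (fun x => norm_nonneg _) v
  have hb := abs_le_norm_of_le_posPart (C := 1) (fun x => by simpa using hf x) zero_le_one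
  refine ⟨f.mkContinuous 1 hb, fun x hx => ?_, fun x => ?_, ?_⟩
  · have h := hf (-x)
    simp only [map_neg, posPart_of_nonpos (neg_nonpos.2 hx), norm_zero] at h
    simpa using h
  · have := (le_abs_self _).trans (hb x)
    simpa using this
  · simpa [posPart_of_nonneg hv] using hfv

/-- A positive functional is a sum of two positive functionals on which the value at `a ⊔ b` is
the value at `a` and at `b`, respectively. -/
theorem IsPositiveFunctional.exists_add_eq_sup {y : StrongDual ℝ X} (hy : IsPositiveFunctional y)
    (a b : X) : ∃ y₁ y₂ : StrongDual ℝ X, IsPositiveFunctional y₁ ∧ IsPositiveFunctional y₂ ∧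
      y = y₁ + y₂ ∧ y₁ (a ⊔ b) = y₁ a ∧ y₂ (a ⊔ b) = y₂ b := by
  -- Domination by y(x⁺) means 0 ≤ f ≤ y. Attaining it at a - b makes f carry all of y on (a - b)⁺
  -- and vanish on (a - b)⁻, so f and y - f are the two summands.
  obtain ⟨f, hf, hfv⟩ := exists_linear_le_sublinear_eq (fun x : X => y x⁺)
    (fun c hc x => by simp only [posPart_smul_of_pos hc, map_smul, smul_eq_mul])
    (fun x z => by simpa using hy.mono (posPart_add_le x z))
    (fun x => hy _ (posPart_nonneg x)) (a - b)
  have hb := abs_le_norm_of_le_posPart (C := ‖y‖)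
    (fun x => (hf x).trans ((le_abs_self _).trans (y.le_opNorm _))) (norm_nonneg y)
  have hpos : ∀ x : X, 0 ≤ x → 0 ≤ f x := fun x hx => by
    have h := hf (-x)
    simp only [map_neg, posPart_of_nonpos (neg_nonpos.2 hx), map_zero] at h
    linarith
  have hle : ∀ x : X, 0 ≤ x → f x ≤ y x := fun x hx => by
    have h := hf x
    rwa [posPart_of_nonneg hx] at h
  have h1 := hle _ (posPart_nonneg (a - b))
  have h2 := hpos _ (negPart_nonneg (a - b))
  have h3 : f (a - b)⁺ - f (a - b)⁻ = f (a - b) := by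
    rw [← map_sub, posPart_sub_negPart]
  have h4 : a ⊔ b = b + (a - b)⁺ := by
    rw [posPart_def, add_sup]
    simp
  have h5 : a ⊔ b = a + (a - b)⁻ := by
    rw [negPart_def, add_sup]
    simp [sup_comm]
  refine ⟨f.mkContinuous _ hb, y - f.mkContinuous _ hb, fun x hx => by simpa using hpos x hx,
    fun x hx => by simpa using hle x hx, by abel, ?_, ?_⟩
  · rw [h5]
    simp only [LinearMap.mkContinuous_apply, map_add]
    linarith
  · rw [h4]
    simp only [sub_apply, LinearMap.mkContinuous_apply, map_add]
    linarith

/-- A positive linear map from a Banach lattice to a normed lattice is bounded. -/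
theorem LinearMap.exists_bound_of_positive [CompleteSpace X] {Y : Type*} [NormedAddCommGroup Y]
    [NormedSpace ℝ Y] [Lattice Y] [IsOrderedAddMonoid Y] [HasSolidNorm Y]
    (S : X →ₗ[ℝ] Y) (hS : ∀ x, 0 ≤ x → 0 ≤ S x) : ∃ C, ∀ x, ‖S x‖ ≤ C * ‖x‖ := by
  have mono : ∀ {a b : X}, a ≤ b → S a ≤ S b := fun {a b} h => by
    have := hS (b - a) (sub_nonneg.2 h)
    rwa [map_sub, sub_nonneg] at this
  have habs : ∀ x, ‖S x‖ ≤ ‖S |x|‖ := fun x => by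
    refine HasSolidNorm.solid ?_
    rw [abs_of_nonneg (hS _ (abs_nonneg x))]
    refine abs_le'.2 ⟨mono (le_abs_self x), ?_⟩
    rw [← map_neg]
    exact mono (neg_le_abs x)
  by_contra! hcon
  -- If S is unbounded, there is a summable positive sequence with unbounded images. Its sum
  -- dominates every term, so ‖S (∑ x_k)‖ would exceed every n.
  have hx : ∀ n : ℕ, ∃ x : X, 0 ≤ x ∧ ‖x‖ ≤ (1 / 2) ^ n ∧ (n : ℝ) ≤ ‖S x‖ := by
    intro n
    obtain ⟨x, hx⟩ := hcon ((n : ℝ) * 2 ^ n)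
    have hx0 : 0 < ‖x‖ := by
      refine norm_pos_iff.2 ?_
      rintro rfl
      simp at hx
    refine ⟨((1 / 2) ^ n * ‖x‖⁻¹) • |x|, smul_nonneg (by positivity) (abs_nonneg x), ?_, ?_⟩
    · rw [norm_smul, norm_abs_eq_norm, Real.norm_of_nonneg (by positivity), mul_assoc,
        inv_mul_cancel₀ hx0.ne', mul_one]
    · rw [map_smul, norm_smul, Real.norm_of_nonneg (by positivity)]
      calc (n : ℝ) = (1 / 2) ^ n * ‖x‖⁻¹ * (n * 2 ^ n * ‖x‖) := by
            rw [one_div, inv_pow]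
            field_simp
        _ ≤ _ := mul_le_mul_of_nonneg_left (hx.le.trans (habs x)) (by positivity)
  choose x hx0 hxn hxS using hx
  have hsum : Summable x :=
    Summable.of_norm_bounded (summable_geometric_of_lt_one (by norm_num) (by norm_num)) hxn
  obtain ⟨n, hn⟩ := exists_nat_gt ‖S (∑' k, x k)‖
  have h1 : x n ≤ ∑' k, x k := hsum.le_tsum n fun k _ => hx0 k
  have h2 := Complexification.norm_le_norm_of_nonneg (hS _ (hx0 n)) (mono h1)
  linarith [hxS n]

end PositiveFunctionals

/-! ### The modulus under positive maps and lattice homomorphisms. -/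

section LatticeHomModulus

variable {X : Type*} [NormedAddCommGroup X] [NormedSpace ℝ X] [Lattice X]
  [IsOrderedAddMonoid X] [IsOrderedModule ℝ X] [HasSolidNorm X] [CompleteSpace X]

/-- The modulus is approximated by finite suprema of rotations. -/
theorem Complexification.modulus_le_sup'_add (z : Complexification X) (n : ℕ) :
    z.modulus ≤ (Finset.range (n + 1 + 1)).sup' Finset.nonempty_range_add_one
      (fun k : ℕ => Real.cos (2 * Real.pi / (n + 1) * k) • z.re
        + Real.sin (2 * Real.pi / (n + 1) * k) • z.im)
      + (2 * Real.pi / (n + 1)) • (|z.re| + |z.im|) := by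
  refine z.isLUB_modulus.2 ?_
  rintro _ ⟨θ, hθ, rfl⟩
  have hpi := Real.pi_pos
  set c : ℝ := 2 * Real.pi / (n + 1) with hc
  have hcn : 0 < c := by positivity
  -- The node just below θ has this index. The value n + 1 occurs at θ = 2π, hence n + 2 nodes.
  have hle : ⌊θ / c⌋₊ ≤ n + 1 := by
    have h1 : θ / c ≤ ((n + 1 : ℕ) : ℝ) := by
      rw [div_le_iff₀ hcn, hc]
      have : ((n + 1 : ℕ) : ℝ) * (2 * Real.pi / (n + 1)) = 2 * Real.pi := by
        push_cast
        field_simp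
      rw [this]
      exact hθ.2
    have := Nat.floor_mono h1
    rwa [Nat.floor_natCast] at this
  have h2 : |θ - c * (⌊θ / c⌋₊ : ℝ)| ≤ c := by
    have ha := Nat.floor_le (div_nonneg hθ.1 hcn.le)
    have hb := (Nat.lt_floor_add_one (θ / c)).le
    rw [le_div_iff₀ hcn] at ha
    rw [div_le_iff₀ hcn] at hb
    rw [abs_le]
    constructor <;> nlinarith
  exact (rotation_le z.re z.im θ _).trans (add_le_add
    (Finset.le_sup' (fun k : ℕ => Real.cos (c * k) • z.re + Real.sin (c * k) • z.im)
      (Finset.mem_range.2 (Nat.lt_succ_of_le hle)))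
    (smul_le_smul_of_nonneg_right h2 (add_nonneg (abs_nonneg _) (abs_nonneg _))))

/-- Positivity of S is enough, since S preserves the inequalities between rotations and modulus. It
gives the complexification of S the same norm bound as S. -/
theorem Complexification.modulus_map_le {Y : Type*} [NormedAddCommGroup Y] [NormedSpace ℝ Y]
    [Lattice Y] [IsOrderedAddMonoid Y] [IsOrderedModule ℝ Y] [HasSolidNorm Y] [CompleteSpace Y]
    (S : X →ₗ[ℝ] Y) (hS : ∀ x, 0 ≤ x → 0 ≤ S x) (z : Complexification X) :
    modulus ⟨S z.re, S z.im⟩ ≤ S z.modulus := by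
  refine modulus_le fun θ => ?_
  have h := hS _ (sub_nonneg.2 (z.rotation_le_modulus θ))
  rw [map_sub, sub_nonneg] at h
  simpa using h

theorem Complex.exists_norm_eq_rotation (a b : ℝ) :
    ∃ θ : ℝ, ‖(a : ℂ) + Complex.I * b‖ = Real.cos θ * a + Real.sin θ * b := by
  set w : ℂ := (a : ℂ) + Complex.I * b with hw
  have h1 := Complex.norm_mul_cos_arg w
  have h2 := Complex.norm_mul_sin_arg w
  have ha : w.re = a := by simp [hw]
  have hb : w.im = b := by simp [hw]
  rw [ha] at h1
  rw [hb] at h2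
  refine ⟨w.arg, ?_⟩
  rw [← h1, ← h2]
  linear_combination (-‖w‖) * Real.sin_sq_add_cos_sq w.arg

/-- The left side is the real part of (a + ib) e^{-iθ}. -/
theorem Complex.rotation_le_norm (a b θ : ℝ) :
    Real.cos θ * a + Real.sin θ * b ≤ ‖(a : ℂ) + Complex.I * b‖ := by
  have h := Complex.abs_re_le_norm (((a : ℂ) + Complex.I * b) * Complex.exp (-θ * Complex.I))
  have h3 : ‖Complex.exp (-θ * Complex.I)‖ = 1 := by
    have := Complex.norm_exp_ofReal_mul_I (-θ)
    rwa [Complex.ofReal_neg] at this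
  rw [norm_mul, h3, mul_one] at h
  refine le_trans (le_of_eq ?_) ((le_abs_self _).trans h)
  have : Complex.exp (-θ * Complex.I) = Real.cos θ - Real.sin θ * Complex.I := by
    rw [Complex.exp_mul_I]
    simp [sub_eq_add_neg]
  rw [this]
  simp only [Complex.mul_re, Complex.add_re, Complex.sub_re, Complex.add_im, Complex.sub_im,
    Complex.ofReal_re, Complex.ofReal_im, Complex.I_re, Complex.I_im, Complex.mul_im]
  ring

/-- A real-valued lattice homomorphism sends the modulus to the absolute value. -/
theorem Complexification.map_modulus_eq_norm (S : X →ₗ[ℝ] ℝ)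
    (hS : ∀ x y, S (x ⊔ y) = S x ⊔ S y) (z : Complexification X) :
    S z.modulus = ‖(S z.re : ℂ) + Complex.I * (S z.im : ℂ)‖ := by
  have hpos := S.map_nonneg_of_map_sup hS
  have mono : ∀ {a b : X}, a ≤ b → S a ≤ S b := fun {a b} h => by
    have := hpos (b - a) (sub_nonneg.2 h)
    rwa [map_sub, sub_nonneg] at this
  apply le_antisymm
  -- S commutes with finite suprema only, so the modulus is replaced by a finite supremum of
  -- rotations. The error is a multiple of the fixed vector |re| + |im| and vanishes in the limit
  -- without continuity of S.
  · have hlim : Filter.Tendsto (fun n : ℕ => ‖(S z.re : ℂ) + Complex.I * (S z.im : ℂ)‖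
        + (2 * Real.pi * S (|z.re| + |z.im|)) * (1 / ((n : ℝ) + 1))) Filter.atTop
        (nhds (‖(S z.re : ℂ) + Complex.I * (S z.im : ℂ)‖
          + (2 * Real.pi * S (|z.re| + |z.im|)) * 0)) :=
      (tendsto_one_div_add_atTop_nhds_zero_nat.const_mul _).const_add _
    rw [mul_zero, add_zero] at hlim
    refine ge_of_tendsto' hlim fun n => ?_
    refine (mono (z.modulus_le_sup'_add n)).trans ?_
    rw [map_add, map_smul, Finset.apply_sup'_eq_sup'_comp _ S hS, smul_eq_mul]
    refine add_le_add (Finset.sup'_le _ _ fun k _ => ?_) (le_of_eq (by ring))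
    simp only [Function.comp, map_add, map_smul, smul_eq_mul]
    exact Complex.rotation_le_norm _ _ _
  · obtain ⟨θ, hθ⟩ := Complex.exists_norm_eq_rotation (S z.re) (S z.im)
    rw [hθ]
    simpa using mono (z.rotation_le_modulus θ)

end LatticeHomModulus

/-! ### The approximate graph of the extension and its norm bound. -/

section Representation

theorem IsPositiveFunctional.add {X : Type*} [NormedAddCommGroup X] [NormedSpace ℝ X] [Lattice X]
    {y y' : StrongDual ℝ X} (hy : IsPositiveFunctional y) (hy' : IsPositiveFunctional y') :
    IsPositiveFunctional (y + y') := fun x hx => add_nonneg (hy x hx) (hy' x hx)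

/-- Common refinement of two decompositions of a positive functional. -/
theorem IsPositiveFunctional.mem_closure_inter {X : Type*} [NormedAddCommGroup X]
    [NormedSpace ℝ X] [Lattice X] {C D : Set (StrongDual ℝ X)}
    (hC : ∀ y ∈ C, IsPositiveFunctional y)
    (hC' : ∀ y ∈ C, ∀ y', IsPositiveFunctional y' → IsPositiveFunctional (y - y') → y' ∈ C)
    (hD : ∀ y ∈ D, IsPositiveFunctional y)
    (h : ∀ y, IsPositiveFunctional y → y ∈ AddSubmonoid.closure C)
    (h' : ∀ y, IsPositiveFunctional y → y ∈ AddSubmonoid.closure D)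
    {y : StrongDual ℝ X} (hy : IsPositiveFunctional y) :
    y ∈ AddSubmonoid.closure (C ∩ D) := by
  have hpos : ∀ x ∈ AddSubmonoid.closure D, IsPositiveFunctional x := fun x hx => by
    induction hx using AddSubmonoid.closure_induction with
    | mem x hx => exact hD x hx
    | zero => exact fun x _ => le_rfl
    | add x z _ _ hx hz => exact hx.add hz
  -- When x ∈ C is written as a sum of elements of D, each summand lies below x by positivity, hence
  -- is in C, which is closed downwards.
  have key : ∀ x ∈ AddSubmonoid.closure D, x ∈ C → x ∈ AddSubmonoid.closure (C ∩ D) := by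
    intro x hx
    induction hx using AddSubmonoid.closure_induction with
    | mem x hx => exact fun hxC => AddSubmonoid.subset_closure ⟨hxC, hx⟩
    | zero => exact fun _ => zero_mem _
    | add x z hx hz ihx ihz =>
      intro hxz
      refine add_mem (ihx (hC' _ hxz x (hpos x hx) ?_)) (ihz (hC' _ hxz z (hpos z hz) ?_))
      · simpa using hpos z hz
      · simpa using hpos x hx
  have hle : AddSubmonoid.closure C ≤ AddSubmonoid.closure (C ∩ D) :=
    AddSubmonoid.closure_le.2 fun x hx => key x (h' x (hC x hx)) hx
  exact hle (h y hy)

variable {E : Type*} [NormedAddCommGroup E] [NormedSpace ℂ E]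
  {X : Type*} [NormedAddCommGroup X] [NormedSpace ℝ X] [Lattice X]

/-- The positive functionals `y` such that `f (y' ∘ R) = y' u` for all `0 ≤ y' ≤ y`, where
`p = (f, u)`. -/
def representingFunctionals (R : E →L[ℝ] X) (p : RenormedFBL E × X) : Set (StrongDual ℝ X) :=
  {y | IsPositiveFunctional y ∧ ∀ y' : StrongDual ℝ X, IsPositiveFunctional y' →
    IsPositiveFunctional (y - y') → p.1 (y'.comp R) = y' p.2}

theorem representingFunctionals_apply {R : E →L[ℝ] X} {p : RenormedFBL E × X}
    {y : StrongDual ℝ X} (hy : y ∈ representingFunctionals R p) : p.1 (y.comp R) = y p.2 :=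
  hy.2 y hy.1 fun x _ => by simp

/-- This heredity is why `representingFunctionals` tests every y' below y and not just y: common
refinements of decompositions depend on it. -/
theorem representingFunctionals_of_le {R : E →L[ℝ] X} {p : RenormedFBL E × X}
    {y : StrongDual ℝ X} (hy : y ∈ representingFunctionals R p) {y' : StrongDual ℝ X}
    (hy' : IsPositiveFunctional y') (hle : IsPositiveFunctional (y - y')) :
    y' ∈ representingFunctionals R p :=
  ⟨hy', fun z hz hz' => hy.2 z hz (by simpa using hle.add hz')⟩

theorem mem_closure_representingFunctionals_inter {R : E →L[ℝ] X} {p q : RenormedFBL E × X}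
    (hp : ∀ y, IsPositiveFunctional y → y ∈ AddSubmonoid.closure (representingFunctionals R p))
    (hq : ∀ y, IsPositiveFunctional y → y ∈ AddSubmonoid.closure (representingFunctionals R q))
    {y : StrongDual ℝ X} (hy : IsPositiveFunctional y) :
    y ∈ AddSubmonoid.closure (representingFunctionals R p ∩ representingFunctionals R q) :=
  hy.mem_closure_inter (fun _ h => h.1) (fun _ h _ h1 h2 => representingFunctionals_of_le h h1 h2)
    (fun _ h => h.1) hp hq

/-- The pairs `(f, u)` such that `u` is the value at `f` of the lattice homomorphism induced by
`R`, tested on decompositions of positive functionals. -/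
def representationSubmodule (R : E →L[ℝ] X) : Submodule ℝ (RenormedFBL E × X) where
  carrier := {p | ∀ y, IsPositiveFunctional y →
    y ∈ AddSubmonoid.closure (representingFunctionals R p)}
  zero_mem' y hy := AddSubmonoid.subset_closure ⟨hy, fun y' _ _ => (map_zero y').symm⟩
  add_mem' {p q} hp hq y hy := by
    refine AddSubmonoid.closure_mono ?_ (mem_closure_representingFunctionals_inter hp hq hy)
    rintro z ⟨hz, hz'⟩
    refine ⟨hz.1, fun y' h1 h2 => ?_⟩
    have e : (p + q).1 (y'.comp R) = p.1 (y'.comp R) + q.1 (y'.comp R) := rfl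
    rw [e, hz.2 y' h1 h2, hz'.2 y' h1 h2, Prod.snd_add, map_add]
  smul_mem' c p hp y hy := by
    refine AddSubmonoid.closure_mono ?_ (hp y hy)
    intro z hz
    refine ⟨hz.1, fun y' h1 h2 => ?_⟩
    have e : (c • p).1 (y'.comp R) = c * p.1 (y'.comp R) := rfl
    rw [e, hz.2 y' h1 h2, Prod.smul_snd, map_smul, smul_eq_mul]

theorem deltaReal_mem_representationSubmodule (R : E →L[ℝ] X) (x : E) :
    (deltaReal x, R x) ∈ representationSubmodule R := fun _ hy =>
  AddSubmonoid.subset_closure ⟨hy, fun _ _ _ => rfl⟩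

variable [IsOrderedAddMonoid X] [IsOrderedModule ℝ X] [HasSolidNorm X]

/-- Pass to a common refinement for p and q, then split each piece into a part that sees the
supremum of the second components as p.2 and a part that sees it as q.2. -/
theorem sup_mem_representationSubmodule (R : E →L[ℝ] X) {p q : RenormedFBL E × X}
    (hp : p ∈ representationSubmodule R) (hq : q ∈ representationSubmodule R) :
    p ⊔ q ∈ representationSubmodule R := by
  intro y hy
  have hle : AddSubmonoid.closure (representingFunctionals R p ∩ representingFunctionals R q)
      ≤ AddSubmonoid.closure (representingFunctionals R (p ⊔ q)) := by
    refine AddSubmonoid.closure_le.2 ?_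
    rintro z ⟨hz, hz'⟩
    obtain ⟨y₁, y₂, h1, h2, rfl, e1, e2⟩ := hz.1.exists_add_eq_sup p.2 q.2
    -- If y'' vanishes on b - a ≥ 0, so does every positive y' ≤ y''. Thus the splitting identities
    -- pass to all smaller functionals, as the hereditary definition demands.
    have aux : ∀ {y' y'' : StrongDual ℝ X} {a b : X}, IsPositiveFunctional y' →
        IsPositiveFunctional (y'' - y') → a ≤ b → y'' b = y'' a → y' b = y' a := by
      intro y' y'' a b h h' hab e
      have h3 := h (b - a) (sub_nonneg.2 hab)
      have h4 := h' (b - a) (sub_nonneg.2 hab)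
      simp only [sub_apply, map_sub, e] at h3 h4
      linarith
    have val : ∀ y' : StrongDual ℝ X, IsPositiveFunctional y' →
        IsPositiveFunctional (y₁ + y₂ - y') → (p ⊔ q).1 (y'.comp R) = y' p.2 ⊔ y' q.2 := by
      intro y' h h'
      have e : (p ⊔ q).1 (y'.comp R) = p.1 (y'.comp R) ⊔ q.1 (y'.comp R) := rfl
      rw [e, hz.2 y' h h', hz'.2 y' h h']
    refine add_mem (AddSubmonoid.subset_closure ⟨h1, fun y' h h' => ?_⟩)
      (AddSubmonoid.subset_closure ⟨h2, fun y' h h' => ?_⟩)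
    · rw [val y' h (by simpa [sub_add_eq_add_sub] using h'.add h2)]
      have e := aux h h' le_sup_left e1
      rw [Prod.snd_sup, e, sup_eq_left, ← e]
      exact h.mono le_sup_right
    · rw [val y' h (by simpa [add_sub_assoc] using h1.add h')]
      have e := aux h h' le_sup_right e2
      rw [Prod.snd_sup, e, sup_eq_right, ← e]
      exact h.mono le_sup_left
  exact hle (mem_closure_representingFunctionals_inter hp hq hy)

/-- Positive homogeneity rescales the defining supremum. For c = 0 all z_j vanish, and so does f at
0. -/
theorem sum_norm_apply_rePart_le {f : StrongDual ℝ E → ℝ} (hf : f ∈ FBL E) {m : ℕ}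
    {z : Fin m → StrongDual ℂ E} {c : ℝ} (hc : 0 ≤ c) (hz : ∀ x, ∑ j, ‖z j x‖ ≤ c * ‖x‖) :
    ∑ j, |f (rePart (z j))| ≤ c * (cfblNorm f).toReal := by
  have hom := (isClosedSublattice_FBL.le_H1 hf).1
  rcases hc.eq_or_lt with rfl | hc
  · have h0 : ∀ j, f (rePart (z j)) = 0 := fun j => by
      have : z j = 0 := by
        ext x
        have h := hz x
        rw [zero_mul] at h
        have h1 := (Finset.sum_eq_zero_iff_of_nonneg fun i _ => norm_nonneg _).1
          (le_antisymm h (Finset.sum_nonneg fun i _ => norm_nonneg _)) j (Finset.mem_univ j)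
        exact norm_eq_zero.1 h1
      have h2 : rePart (z j) = (0 : ℝ) • rePart (z j) := by
        rw [this]
        ext x
        simp
      rw [h2, hom 0 _ le_rfl, zero_mul]
    simp [h0]
  · have hadm : IsAdmissible ℂ E m (fun j => ((c⁻¹ : ℝ) : ℂ) • z j) := by
      intro x hx
      simp only [smul_apply, norm_smul, Complex.norm_real,
        Real.norm_of_nonneg (inv_nonneg.2 hc.le)]
      rw [← Finset.mul_sum, inv_mul_le_iff₀ hc]
      exact (hz x).trans (mul_le_mul_of_nonneg_left hx hc.le)
    have h : _ ≤ cfblNorm f := le_tupleSup hadm (fun z => f (rePart z))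
    have h5 : ∀ j, f (rePart (((c⁻¹ : ℝ) : ℂ) • z j)) = c⁻¹ * f (rePart (z j)) := by
      intro j
      rw [← hom _ _ (inv_nonneg.2 hc.le)]
      congr 1
      ext x
      simp only [rePart_apply, smul_apply, smul_eq_mul, Complex.re_ofReal_mul]
    simp only [h5, norm_mul, Real.norm_of_nonneg (inv_nonneg.2 hc.le)] at h
    rw [← Finset.mul_sum, ENNReal.ofReal_le_iff_le_toReal (cfblNorm_ne_top hf),
      inv_mul_le_iff₀ hc] at h
    exact h

variable [CompleteSpace X]

theorem Complexification.norm_re_le (z : Complexification X) : ‖z.re‖ ≤ ‖z‖ :=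
  HasSolidNorm.solid (by rw [abs_of_nonneg z.modulus_nonneg]; exact z.abs_re_le_modulus)

/-- The real part of an operator into a complex Banach lattice. -/
noncomputable def reOperator (T : E →L[ℂ] Complexification X) : E →L[ℝ] X :=
  LinearMap.mkContinuous
    { toFun := fun x => (T x).re
      map_add' := fun x y => by rw [map_add, Complexification.add_re]
      map_smul' := fun c x => by
        rw [← Complex.coe_smul c x, map_smul, Complexification.smul_re]
        simp }
    ‖T‖ fun x => (T x).norm_re_le.trans (T.le_opNorm x)

@[simp] theorem reOperator_apply (T : E →L[ℂ] Complexification X) (x : E) :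
    reOperator T x = (T x).re := rfl

/-- The complex functional is x ↦ y(Re T x) + i y(Im T x). Its absolute value is y applied to one
rotation of T x, and every rotation lies below the modulus. -/
theorem IsPositiveFunctional.norm_extendRCLike_reOperator_le {y : StrongDual ℝ X}
    (hy : IsPositiveFunctional y) (T : E →L[ℂ] Complexification X) (x : E) :
    ‖(StrongDual.extendRCLike (y.comp (reOperator T)) : StrongDual ℂ E) x‖
      ≤ y (T x).modulus := by
  have h : (StrongDual.extendRCLike (y.comp (reOperator T)) : StrongDual ℂ E) x
      = (y (T x).re : ℂ) + Complex.I * (y (T x).im : ℂ) := by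
    rw [StrongDual.extendRCLike_apply]
    simp
  obtain ⟨θ, hθ⟩ := Complex.exists_norm_eq_rotation (y (T x).re) (y (T x).im)
  rw [h, hθ]
  simpa using hy.mono ((T x).rotation_le_modulus θ)

theorem rePart_extendRCLike (φ : StrongDual ℝ E) :
    rePart (StrongDual.extendRCLike φ : StrongDual ℂ E) = φ := by
  ext x
  exact StrongDual.re_extendRCLike_apply (𝕜 := ℂ) φ x

/-- The pieces of a positive functional norming |p.2| yield a tuple of complex functionals with
constant ‖T‖, on which the norm of p.1 is tested. -/
theorem norm_le_of_mem_representationSubmodule (T : E →L[ℂ] Complexification X)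
    {p : RenormedFBL E × X} (hp : p ∈ representationSubmodule (reOperator T)) :
    ‖p.2‖ ≤ ‖T‖ * ‖p.1‖ := by
  obtain ⟨y, hy, hy1, hy2⟩ := exists_isPositiveFunctional_eq_norm (abs_nonneg p.2)
  -- The pair p ⊔ -p is (|p.1|, |p.2|), so the decomposition represents absolute values and no signs
  -- need tracking.
  obtain ⟨l, hl, hsum⟩ := AddSubmonoid.exists_list_of_mem_closure
    (sup_mem_representationSubmodule _ hp (neg_mem hp) y hy)
  have hsum' : ∀ v, y v = ∑ j : Fin l.length, l[j] v := by
    intro v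
    rw [← hsum, ← Fin.sum_univ_getElem, sum_apply]
    rfl
  have hmem : ∀ j : Fin l.length, l[j] ∈ representingFunctionals (reOperator T) (p ⊔ -p) :=
    fun j => hl _ (List.getElem_mem _)
  have hz : ∀ x : E, ∑ j : Fin l.length,
      ‖(StrongDual.extendRCLike (l[j].comp (reOperator T)) : StrongDual ℂ E) x‖ ≤ ‖T‖ * ‖x‖ := by
    intro x
    calc _ ≤ ∑ j : Fin l.length, l[j] (T x).modulus :=
          Finset.sum_le_sum fun j _ => (hmem j).1.norm_extendRCLike_reOperator_le T x
      _ = y (T x).modulus := (hsum' _).symm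
      _ ≤ ‖T x‖ := hy1 _
      _ ≤ ‖T‖ * ‖x‖ := T.le_opNorm x
  have h := sum_norm_apply_rePart_le p.1.2 (norm_nonneg T) hz
  rw [← norm_abs_eq_norm, ← hy2, hsum']
  refine le_trans (Finset.sum_le_sum fun j _ => ?_) h
  rw [rePart_extendRCLike]
  exact (representingFunctionals_apply (hmem j)).ge

end Representation

/-! ### Extension, uniqueness, the norm formula and the isometry. -/

section FreeObject

variable {E : Type*} [NormedAddCommGroup E] [NormedSpace ℂ E]

/-- `FBL[E_ℝ]` is generated, as a closed sublattice, by the evaluations. -/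
theorem RenormedFBL.mem_of_isClosed (K : Submodule ℝ (RenormedFBL E))
    (hK : IsClosed (K : Set (RenormedFBL E))) (hsup : ∀ f ∈ K, ∀ g ∈ K, f ⊔ g ∈ K)
    (hδ : ∀ x : E, deltaReal x ∈ K) (f : RenormedFBL E) : f ∈ K := by
  -- Minimality of `FBL` refers to `fblNorm`, whereas K is closed for the new norm. As `cfblNorm` ≤
  -- `fblNorm`, approximation in the former sense implies approximation in the latter.
  have hS : IsClosedSublattice (K.map (FBL E).subtype) := by
    refine ⟨?_, ?_, ?_⟩
    · rintro _ ⟨g, -, rfl⟩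
      exact isClosedSublattice_FBL.le_H1 g.2
    · rintro _ ⟨g, hg, rfl⟩ _ ⟨h, hh, rfl⟩
      exact ⟨_, hsup g hg h hh, rfl⟩
    · intro g hg happ
      have hmem : g ∈ FBL E := isClosedSublattice_FBL.closed g hg fun ε hε => by
        obtain ⟨_, ⟨h, -, rfl⟩, hh⟩ := happ ε hε
        exact ⟨_, h.2, hh⟩
      let g' : RenormedFBL E := ⟨g, hmem⟩
      refine ⟨g', ?_, rfl⟩
      refine hK.closure_subset (Metric.mem_closure_iff.2 fun ε hε => ?_)
      obtain ⟨_, ⟨h, hh, rfl⟩, hlt⟩ := happ (ENNReal.ofReal ε) (ENNReal.ofReal_pos.2 hε)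
      refine ⟨h, hh, ?_⟩
      let h' : RenormedFBL E := h
      change dist g' h' < ε
      rw [dist_eq_norm, ← ENNReal.ofReal_lt_ofReal_iff hε, RenormedFBL.ofReal_norm]
      exact (cfblNorm_le _).trans_lt hlt
  obtain ⟨g, hg, hgf⟩ := Submodule.mem_sInf.1 f.2 _ ⟨hS, fun x => ⟨deltaReal x, hδ x, rfl⟩⟩
  have : g = f := Subtype.ext hgf
  exact this ▸ hg

/-- Lattice homomorphisms are positive, hence continuous, so the set where the two agree is a closed
sublattice. No boundedness has to be assumed. -/
theorem RenormedFBL.eq_of_map_sup {X : Type*} [NormedAddCommGroup X] [NormedSpace ℝ X]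
    [Lattice X] [IsOrderedAddMonoid X] [HasSolidNorm X] {S S' : RenormedFBL E →ₗ[ℝ] X}
    (hS : ∀ f g, S (f ⊔ g) = S f ⊔ S g) (hS' : ∀ f g, S' (f ⊔ g) = S' f ⊔ S' g)
    (h : ∀ x : E, S (deltaReal x) = S' (deltaReal x)) : S = S' := by
  obtain ⟨C, hC⟩ := S.exists_bound_of_positive (S.map_nonneg_of_map_sup hS)
  obtain ⟨C', hC'⟩ := S'.exists_bound_of_positive (S'.map_nonneg_of_map_sup hS')
  have hcont : Continuous S := (S.mkContinuous C hC).continuous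
  have hcont' : Continuous S' := (S'.mkContinuous C' hC').continuous
  refine LinearMap.ext fun f => RenormedFBL.mem_of_isClosed (LinearMap.eqLocus S S')
    (isClosed_eq hcont hcont') (fun f hf g hg => ?_) h f
  have hf' : S f = S' f := hf
  have hg' : S g = S' g := hg
  change S (f ⊔ g) = S' (f ⊔ g)
  rw [hS, hS', hf', hg']

variable {X : Type*} [NormedAddCommGroup X] [NormedSpace ℝ X] [Lattice X]
  [IsOrderedAddMonoid X] [IsOrderedModule ℝ X] [HasSolidNorm X] [CompleteSpace X]

theorem exists_map_sup_extension (T : E →L[ℂ] Complexification X) :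
    ∃ S : RenormedFBL E →ₗ[ℝ] X, (∀ f g, S (f ⊔ g) = S f ⊔ S g) ∧
      (∀ x, S (deltaReal x) = (T x).re) ∧ ∀ f, ‖S f‖ ≤ ‖T‖ * ‖f‖ := by
  -- The closure keeps both the norm bound and stability under suprema, and completeness then turns
  -- it into the graph of an everywhere defined map.
  set G := (representationSubmodule (reOperator T)).topologicalClosure
  have hclosed : IsClosed (G : Set (RenormedFBL E × X)) := Submodule.isClosed_topologicalClosure _
  have hbound : ∀ p ∈ G, ‖p.2‖ ≤ ‖T‖ * ‖p.1‖ := fun p hp =>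
    closure_minimal (t := {p : RenormedFBL E × X | ‖p.2‖ ≤ ‖T‖ * ‖p.1‖})
      (fun p hp => norm_le_of_mem_representationSubmodule T hp)
      (isClosed_le (by fun_prop) (by fun_prop)) hp
  have hsup : ∀ p ∈ G, ∀ q ∈ G, p ⊔ q ∈ G := fun p hp q hq =>
    map_mem_closure₂ (f := fun p q : RenormedFBL E × X => p ⊔ q)
      ((continuous_fst.fst.sup continuous_snd.fst).prodMk
        (continuous_fst.snd.sup continuous_snd.snd)) hp hq
      fun p hp q hq => sup_mem_representationSubmodule _ hp hq
  have hδ : ∀ x, (deltaReal x, (T x).re) ∈ G := fun x =>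
    subset_closure (deltaReal_mem_representationSubmodule (reOperator T) x)
  have : CompleteSpace G := hclosed.completeSpace_coe
  let π : G →L[ℝ] RenormedFBL E := (ContinuousLinearMap.fst ℝ _ _).comp G.subtypeL
  -- On G the first coordinate controls the second, so the projection has closed range. This range
  -- is a sublattice containing the evaluations, hence all of `RenormedFBL E`.
  have hπ : AntilipschitzWith (1 + ‖T‖₊) π := by
    refine AddMonoidHomClass.antilipschitz_of_bound π fun p => ?_
    have h1 := hbound p.1 p.2
    have h2 : (0 : ℝ) ≤ ‖T‖ * ‖p.1.1‖ := by positivity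
    have h3 : ‖π p‖ = ‖p.1.1‖ := rfl
    rw [h3, NNReal.coe_add, NNReal.coe_one, coe_nnnorm, add_mul, one_mul]
    exact max_le (le_add_of_nonneg_right h2) (h1.trans (le_add_of_nonneg_left (norm_nonneg _)))
  have hdom : ∀ f : RenormedFBL E, ∃ u, (f, u) ∈ G := by
    intro f
    obtain ⟨⟨⟨g, u⟩, hp⟩, hpf⟩ := RenormedFBL.mem_of_isClosed (LinearMap.range π.toLinearMap)
      (hπ.isClosed_range π.uniformContinuous)
      (by
        rintro _ ⟨p, rfl⟩ _ ⟨q, rfl⟩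
        exact ⟨⟨_, hsup p.1 p.2 q.1 q.2⟩, rfl⟩)
      (fun x => ⟨⟨_, hδ x⟩, rfl⟩) f
    have e : g = f := hpf
    exact ⟨u, e ▸ hp⟩
  have huniq : ∀ {f : RenormedFBL E} {u v : X}, (f, u) ∈ G → (f, v) ∈ G → u = v := by
    intro f u v hu hv
    -- The difference is (0, u - v), and the bound makes u - v vanish: G is single-valued. Linearity
    -- and suprema for S follow from this alone.
    have h := hbound _ (sub_mem hu hv)
    simp only [Prod.mk_sub_mk, sub_self, norm_zero, mul_zero] at h
    exact sub_eq_zero.1 (norm_le_zero_iff.1 h)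
  choose S hS using hdom
  refine ⟨{ toFun := S
            map_add' := fun f g => huniq (hS _) (add_mem (hS f) (hS g))
            map_smul' := fun c f => huniq (hS _) (G.smul_mem c (hS f)) },
    fun f g => huniq (hS _) (hsup _ (hS f) _ (hS g)), fun x => huniq (hS _) (hδ x),
    fun f => hbound _ (hS f)⟩

/-- The complexification of a positive real operator with a bound. -/
noncomputable def complexify {Y : Type*} [NormedAddCommGroup Y] [NormedSpace ℝ Y]
    [Lattice Y] [IsOrderedAddMonoid Y] [IsOrderedModule ℝ Y] [HasSolidNorm Y] [CompleteSpace Y]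
    (S : X →ₗ[ℝ] Y) (hS : ∀ x, 0 ≤ x → 0 ≤ S x) (C : ℝ) (hC : ∀ x, ‖S x‖ ≤ C * ‖x‖) :
    Complexification X →L[ℂ] Complexification Y :=
  LinearMap.mkContinuous
    { toFun := fun z => ⟨S z.re, S z.im⟩
      map_add' := fun z w => by ext <;> simp
      map_smul' := fun c z => by ext <;> simp }
    C fun z => (Complexification.norm_le_norm_of_nonneg (Complexification.modulus_nonneg _)
      (Complexification.modulus_map_le S hS z)).trans (hC z.modulus)

@[simp] theorem complexify_apply {Y : Type*} [NormedAddCommGroup Y] [NormedSpace ℝ Y]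
    [Lattice Y] [IsOrderedAddMonoid Y] [IsOrderedModule ℝ Y] [HasSolidNorm Y] [CompleteSpace Y]
    (S : X →ₗ[ℝ] Y) (hS : ∀ x, 0 ≤ x → 0 ≤ S x) (C : ℝ) (hC : ∀ x, ‖S x‖ ≤ C * ‖x‖)
    (z : Complexification X) : complexify S hS C hC z = ⟨S z.re, S z.im⟩ := rfl

/-- The modulus in `FBL_ℂ[E]` is the pointwise one. -/
theorem FBLC.modulus_apply (f : FBLC E) (φ : StrongDual ℝ E) :
    f.modulus φ = ‖(f.re φ : ℂ) + Complex.I * (f.im φ : ℂ)‖ :=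
  Complexification.map_modulus_eq_norm
    { toFun := fun g : RenormedFBL E => g φ
      map_add' := fun _ _ => rfl
      map_smul' := fun _ _ => rfl } (fun _ _ => rfl) f

theorem FBLC.ofReal_norm (f : FBLC E) : ENNReal.ofReal ‖f‖ =
    cfblNorm (fun φ : StrongDual ℝ E => (f.re φ : ℂ) + Complex.I * (f.im φ : ℂ)) := by
  rw [Complexification.norm_def, RenormedFBL.ofReal_norm]
  have h : ∀ φ, ‖f.modulus.1 φ‖ = ‖(f.re φ : ℂ) + Complex.I * (f.im φ : ℂ)‖ := fun φ => by
    rw [FBLC.modulus_apply, norm_norm]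
  simp only [cfblNorm, tupleSup, h]

theorem isLinearMap_deltaC : IsLinearMap ℂ (deltaC : E → FBLC E) where
  map_add x y := by
    ext
    · exact Subtype.ext (funext fun φ => map_add φ x y)
    · refine Subtype.ext (funext fun φ => ?_)
      change -φ (Complex.I • (x + y)) = -φ (Complex.I • x) + -φ (Complex.I • y)
      rw [smul_add, map_add, neg_add]
  map_smul c x := by
    have key : ∀ (φ : StrongDual ℝ E) (d : ℂ),
        φ (d • x) = d.re * φ x + d.im * φ (Complex.I • x) := fun φ d => by
      have : d • x = d.re • x + d.im • (Complex.I • x) := by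
        rw [← Complex.coe_smul, ← Complex.coe_smul, smul_smul, ← add_smul, Complex.re_add_im]
      rw [this, map_add, map_smul, map_smul, smul_eq_mul, smul_eq_mul]
    ext
    · refine Subtype.ext (funext fun φ => ?_)
      change φ (c • x) = c.re * φ x - c.im * -φ (Complex.I • x)
      rw [key]
      ring
    · refine Subtype.ext (funext fun φ => ?_)
      change -φ (Complex.I • c • x) = c.re * -φ (Complex.I • x) + c.im * φ x
      rw [smul_smul, key]
      simp

/-- Im w = -Re(iw) explains the sign in `deltaC`. With the norm formula, ‖δ_E(x)‖ becomes a supremum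
of sums ∑ |z_j(x)|. -/
theorem deltaC_apply_rePart (x : E) (z : StrongDual ℂ E) :
    ((deltaC x).re (rePart z) : ℂ) + Complex.I * ((deltaC x).im (rePart z) : ℂ) = z x := by
  have h1 : (deltaC x).re (rePart z) = (z x).re := rfl
  have h2 : (deltaC x).im (rePart z) = (z x).im := by
    change -(z (Complex.I • x)).re = _
    simp
  rw [h1, h2, mul_comm, Complex.re_add_im]

theorem norm_deltaC (x : E) : ‖deltaC x‖ = ‖x‖ := by
  have h := FBLC.ofReal_norm (deltaC x)
  have hadm : ∀ m (z : Fin m → StrongDual ℂ E), IsAdmissible ℂ E m z → ∑ j, ‖z j x‖ ≤ ‖x‖ := by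
    intro m z hz
    rcases eq_or_ne x 0 with rfl | hx
    · simp
    have hx' := norm_pos_iff.2 hx
    have h1 := hz (((‖x‖⁻¹ : ℝ) : ℂ) • x) (by
      rw [norm_smul, Complex.norm_real, Real.norm_of_nonneg (by positivity),
        inv_mul_cancel₀ hx'.ne'])
    simp only [map_smul, norm_smul, Complex.norm_real,
      Real.norm_of_nonneg (inv_nonneg.2 hx'.le)] at h1
    rwa [← Finset.mul_sum, inv_mul_le_iff₀ hx', mul_one] at h1
  have hle : cfblNorm (fun φ : StrongDual ℝ E =>
      ((deltaC x).re φ : ℂ) + Complex.I * ((deltaC x).im φ : ℂ)) = ENNReal.ofReal ‖x‖ := by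
    apply le_antisymm
    · refine tupleSup_le fun m z hz => ENNReal.ofReal_le_ofReal ?_
      simp only [deltaC_apply_rePart]
      exact hadm m z hz
    -- A single norming functional, as a tuple of length one, already attains ‖x‖. This version
    -- gives ‖g‖ ≤ 1 and also covers x = 0.
    · obtain ⟨g, hg, hgx⟩ := exists_dual_vector'' ℂ x
      have h1 : IsAdmissible ℂ E 1 (fun _ => g) := fun y hy => by
        rw [Fin.sum_univ_one]
        exact g.le_of_opNorm_le_of_le hg hy |>.trans (by norm_num)
      refine le_trans (le_of_eq ?_) (le_tupleSup h1 _)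
      simp only [deltaC_apply_rePart, Fin.sum_univ_one, hgx]
      simp
  rw [hle] at h
  exact (ENNReal.ofReal_eq_ofReal_iff (norm_nonneg _) (norm_nonneg _)).1 h

end FreeObject

/-- For a complex Banach space `E`, `FBL_ℂ[E]` together with `δ_E` is the free complex Banach lattice
generated by `E`, and its norm is given by the explicit formula. -/
theorem mainTheorem1 (E : Type u) [NormedAddCommGroup E] [NormedSpace ℂ E]
    [CompleteSpace E] :
    IsFreeComplexBanachLattice.{u, u, w} E (RenormedFBL E) deltaC ∧
    ∀ f : FBLC E, ENNReal.ofReal ‖f‖ =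
      cfblNorm (fun φ : StrongDual ℝ E => (f.re φ : ℂ) + Complex.I * (f.im φ : ℂ)) := by
  refine ⟨⟨isLinearMap_deltaC, ?_, ?_⟩, FBLC.ofReal_norm⟩
  · exact AddMonoidHomClass.isometry_of_norm isLinearMap_deltaC.mk' norm_deltaC
  · intro X _ _ _ _ _ _ _ T
    obtain ⟨S, hsup, hδ, hb⟩ := exists_map_sup_extension T
    have hδ' : ∀ z, complexify S (S.map_nonneg_of_map_sup hsup) ‖T‖ hb (deltaC z) = T z := by
      intro z
      ext
      · exact hδ z
      · rw [complexify_apply]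
        -- Complex linearity of T recovers the imaginary part from the real one: -Re T(iz) = Im T z.
        change S (-deltaReal (Complex.I • z)) = _
        rw [map_neg, hδ, map_smul]
        simp
    refine ⟨complexify S (S.map_nonneg_of_map_sup hsup) ‖T‖ hb, ⟨S, hsup, fun f g => ?_,
      fun z => rfl⟩, hδ', le_antisymm (LinearMap.mkContinuous_norm_le _ (norm_nonneg T) _)
        (T.opNorm_le_bound (norm_nonneg _) fun z => ?_), ?_⟩
    · have h : f ⊓ g = -(-f ⊔ -g) := by rw [neg_sup, neg_neg, neg_neg]
      rw [h, map_neg, hsup, map_neg, map_neg, neg_sup, neg_neg, neg_neg]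
    -- Since δ_E is isometric, T = T' ∘ δ_E gives ‖T‖ ≤ ‖T'‖.
    · rw [← hδ' z, ← norm_deltaC z]
      exact ContinuousLinearMap.le_opNorm _ _
    · rintro R ⟨S', hsup', -, hR⟩ hRδ f
      have e : S' = S := RenormedFBL.eq_of_map_sup hsup' hsup fun x => by
        rw [hδ, ← hRδ x, hR]
        rfl
      rw [hR, e, complexify_apply]
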